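/- All graphs are finite, simple and undirected, with $n$ vertices and $m$ edges. An \emph{efficient dominating set} (e.d.) of $G=(V,E)$ is a set $D\subseteq V$ such that every closed neighbourhood $N[v]$, $v\in V$, contains exactly one vertex of $D$. The \emph{ED problem} asks whether $G$ has an e.d.; the \emph{weighted ED problem} asks, given $\omega:V\to\mathbb N$, for an e.d. of minimum total weight, or the answer that none exists. $G$ is \emph{$2P_2$-free} if it has no induced subgraph that consists of two disjoint edges and has no further edges. A \emph{homogeneous set} of $G$ is a set $H\subsetneq V$ with $|H|\ge 2$ such that every vertex outside $H$ is adjacent to all or to none of the vertices of $H$; $G$ is \emph{prime} if it has none. A \emph{thin spider} is a graph whose vertex set is partitioned into a clique $C$ and an independent set $I$ such that every vertex of $C$ has exactly one neighbour in $I$ and vice versa. If $G$ and its complement are connected, a \emph{characteristic graph} $G^*$ of $G$ is the subgraph induced by the vertices that lie in no homogeneous set together with one representative of each maximal homogeneous set. \textbf{Theorem.} \begin{enumerate} \item The weighted ED problem and the ED problem are robustly solvable in linear time $O(n+m)$ for $2P_2$-free graphs. That is, for each of the two problems there is a random access machine program (unit-cost instructions, words of $O(\log(n+m+W))$ bits with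 $W$ the largest weight, the graph given by adjacency lists in arbitrary order) that on every graph $G$, $2P_2$-free or not, halts after $O(n+m)$ steps (for the empty graph: $O(1)$ steps) and either correctly solves the problem for $G$ (it outputs an e.d. of minimum weight, respectively that an e.d. exists, or it correctly states that $G$ has no e.d.), or correctly states that $G$ is not $2P_2$-free. \item A connected prime $2P_2$-free graph with at least two vertices has an e.d. if and only if it is a thin spider. \item Let $G$ be a graph with at least two vertices such that $G$ and its complement are connected, and let $G^*$ be a characteristic graph of $G$. \begin{enumerate} \item If $G^*$ is a thin spider with partition $V(G^*)=C\cup I$ and no vertex of $I$ lies in a homogeneous set of $G$, then $I$ is an e.d. of $G$, and it is the only one. \item If $G$ is $2P_2$-free and has an e.d., then $G^*$ is a thin spider with a partition $V(G^*)=C\cup I$ as in (a). \end{enumerate} \end{enumerate} -/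

import Mathlib

/-! ## Graph-theoretic notions -/

namespace EffDom

section Graphs

variable {V : Type*} (G : SimpleGraph V)

/-- `d` dominates itself and its neighbours. -/
def Dominates (d v : V) : Prop := d = v ∨ G.Adj d v

/-- Efficient dominating set (e.d.): every vertex is dominated by exactly one vertex of `D`. -/
def IsED (D : Set V) : Prop := ∀ v : V, ∃! d : V, d ∈ D ∧ Dominates G d v

/-- `2P₂`-free: no induced subgraph is the disjoint union of two paths on two vertices. -/
def TwoPTwoFree : Prop :=
  ¬ SimpleGraph.IsIndContained
    (SimpleGraph.sum (SimpleGraph.pathGraph 2) (SimpleGraph.pathGraph 2)) G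

/-- Homogeneous set: at least two vertices, not all vertices, and every outside vertex is
adjacent to all or to none of its elements. -/
def IsHomogeneous (H : Set V) : Prop :=
  H.Nontrivial ∧ H ≠ Set.univ ∧
    ∀ v, v ∉ H → (∀ h ∈ H, G.Adj v h) ∨ (∀ h ∈ H, ¬ G.Adj v h)

/-- A prime graph contains no homogeneous set. -/
def IsPrimeGraph : Prop := ∀ H : Set V, ¬ IsHomogeneous G H

/-- Inclusion-maximal homogeneous set. -/
def IsMaxHomogeneous (H : Set V) : Prop := Maximal (IsHomogeneous G) H

/-- `R` is the vertex set of a characteristic graph of `G`: it has all the vertices that lie in no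
homogeneous set and exactly one representative of each maximal homogeneous set. The
characteristic graph itself is then `G.induce R`. -/
def IsCharacteristicSet (R : Set V) : Prop :=
  (∀ v, (∀ H, IsHomogeneous G H → v ∉ H) → v ∈ R) ∧
    ∀ H, IsMaxHomogeneous G H → ∃! h, h ∈ R ∧ h ∈ H

/-- The vertex set is partitioned into a clique `C` and an independent set `I`, every vertex
of `C` has exactly one neighbour in `I`, and vice versa. -/
structure IsThinSpiderPartition (C I : Set V) : Prop where
  isCompl : IsCompl C I
  isClique : G.IsClique C
  isIndepSet : G.IsIndepSet I
  existsUnique_right : ∀ c ∈ C, ∃! i, i ∈ I ∧ G.Adj c i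
  existsUnique_left : ∀ i ∈ I, ∃! c, c ∈ C ∧ G.Adj i c

/-- Thin spider. -/
def IsThinSpider : Prop := ∃ C I : Set V, IsThinSpiderPartition G C I

/-- The characteristic graph `G.induce R` is a thin spider with independent part `I`, and no vertex
of `I` lies in a homogeneous set of `G`. -/
def IsCharacteristicSpider (R I : Set V) : Prop :=
  (∃ C : Set R, ∃ J : Set R,
    IsThinSpiderPartition (G.induce R) C J ∧ I = Subtype.val '' J) ∧
  ∀ i ∈ I, ∀ H, IsHomogeneous G H → i ∉ H

end Graphs

/-- Efficient dominating set of minimum total weight. -/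
def IsMinWeightED {n : ℕ} (G : SimpleGraph (Fin n)) (ω : Fin n → ℕ) (D : Finset (Fin n)) : Prop :=
  IsED G (D : Set (Fin n)) ∧
    ∀ D' : Finset (Fin n), IsED G (D' : Set (Fin n)) → ∑ v ∈ D, ω v ≤ ∑ v ∈ D', ω v

/-! ## The machine model: a word RAM with unit-cost instructions

A program uses finitely many registers and finitely many arrays (those that occur in it),
all of them holding natural numbers. An array cell is addressed by the content of a register. -/

/-- Memory: `reg x` is register `x`, and `arr a i` is cell `i` of array `a`. -/
structure Store where
  reg : ℕ → ℕ
  arr : ℕ → ℕ → ℕ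

/-- Elementary instructions. -/
inductive Instr : Type
  /-- `x := k` -/
  | const (x k : ℕ)
  /-- `x := y` -/
  | move (x y : ℕ)
  /-- `x := y + z` -/
  | add (x y z : ℕ)
  /-- `x := y - z`, truncated at `0` -/
  | sub (x y z : ℕ)
  /-- `x := a[y]` -/
  | load (x a y : ℕ)
  /-- `a[y] := x` -/
  | write (a y x : ℕ)

namespace Instr

/-- The number that an instruction computes and stores. -/
def value (s : Store) : Instr → ℕ
  | const _ k => k
  | move _ y => s.reg y
  | add _ y z => s.reg y + s.reg z
  | sub _ y z => s.reg y - s.reg z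
  | load _ a y => s.arr a (s.reg y)
  | write _ _ x => s.reg x

/-- The memory after an instruction. -/
def apply (s : Store) (i : Instr) : Store :=
  match i with
  | const x _ | move x _ | add x _ _ | sub x _ _ | load x _ _ =>
      { s with reg := Function.update s.reg x (i.value s) }
  | write a y _ =>
      let row := Function.update (s.arr a) (s.reg y) (i.value s)
      { s with arr := Function.update s.arr a row }

end Instr

/-- Programs. The tests of `branch` and `loop` are `x < y` for registers `x`, `y`. -/
inductive Prog : Type
  | skip
  | instr (i : Instr)
  | seq (p q : Prog)
  /-- `if x < y then p else q` -/
  | branch (x y : ℕ) (p q : Prog)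
  /-- `while x < y do p` -/
  | loop (x y : ℕ) (p : Prog)

/-- `Exec w p s t s'`: on a machine whose words hold the numbers `0, …, w`, the program `p`, started
with memory `s`, halts after exactly `t` steps with memory `s'`. Every instruction and every
test is one step. An instruction whose result exceeds `w` cannot be executed. -/
inductive Exec (w : ℕ) : Prog → Store → ℕ → Store → Prop
  | skip (s) : Exec w .skip s 1 s
  | instr (i s) (h : i.value s ≤ w) : Exec w (.instr i) s 1 (i.apply s)
  | seq {p q s t s' t' s''} (hp : Exec w p s t s') (hq : Exec w q s' t' s'') :
      Exec w (.seq p q) s (t + t') s''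
  | branch_true {x y p q s t s'} (h : s.reg x < s.reg y) (hp : Exec w p s t s') :
      Exec w (.branch x y p q) s (1 + t) s'
  | branch_false {x y p q s t s'} (h : ¬ s.reg x < s.reg y) (hq : Exec w q s t s') :
      Exec w (.branch x y p q) s (1 + t) s'
  | loop_true {x y p s t s' t' s''} (h : s.reg x < s.reg y) (hp : Exec w p s t s')
      (hl : Exec w (.loop x y p) s' t' s'') : Exec w (.loop x y p) s (1 + t + t') s''
  | loop_false {x y p s} (h : ¬ s.reg x < s.reg y) : Exec w (.loop x y p) s 1 s

/-- The machine is deterministic: running time and result are determined by program and input. -/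
theorem Exec.unique {w : ℕ} {p : Prog} {s s₁ : Store} {t₁ : ℕ} (h₁ : Exec w p s t₁ s₁) :
    ∀ {t₂ : ℕ} {s₂ : Store}, Exec w p s t₂ s₂ → t₁ = t₂ ∧ s₁ = s₂ := by
  induction h₁ with
  | skip s => intro t₂ s₂ h; cases h; exact ⟨rfl, rfl⟩
  | instr i s hi => intro t₂ s₂ h; cases h; exact ⟨rfl, rfl⟩
  | seq hp hq ihp ihq =>
    intro t₂ s₂ h
    cases h with
    | seq hp' hq' =>
      obtain ⟨rfl, rfl⟩ := ihp hp'
      obtain ⟨rfl, rfl⟩ := ihq hq'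
      exact ⟨rfl, rfl⟩
  | branch_true hlt hp ih =>
    intro t₂ s₂ h
    cases h with
    | branch_true _ hp' => obtain ⟨rfl, rfl⟩ := ih hp'; exact ⟨rfl, rfl⟩
    | branch_false hn _ => exact absurd hlt hn
  | branch_false hn hp ih =>
    intro t₂ s₂ h
    cases h with
    | branch_true hlt _ => exact absurd hlt hn
    | branch_false _ hp' => obtain ⟨rfl, rfl⟩ := ih hp'; exact ⟨rfl, rfl⟩
  | loop_true hlt hp hl ihp ihl =>
    intro t₂ s₂ h
    cases h with
    | loop_true _ hp' hl' =>
      obtain ⟨rfl, rfl⟩ := ihp hp'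
      obtain ⟨rfl, rfl⟩ := ihl hl'
      exact ⟨rfl, rfl⟩
    | loop_false hn => exact absurd hlt hn
  | loop_false hn =>
    intro t₂ s₂ h
    cases h with
    | loop_true hlt _ _ => exact absurd hlt hn
    | loop_false _ => exact ⟨rfl, rfl⟩

/-! ## Input, output and running time -/

/-- `adj v` lists the neighbours of `v`, each once, in an arbitrary order. -/
def IsAdjLists {n : ℕ} (G : SimpleGraph (Fin n)) (adj : Fin n → List (Fin n)) : Prop :=
  ∀ v, (adj v).Nodup ∧ ∀ u, u ∈ adj v ↔ G.Adj v u

/-- The initial memory, for a graph on the vertices `0, …, n - 1` with vertex weights `ω`.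
Register `0` holds `n`. Array `1` is the concatenation of the adjacency lists of `0, …, n - 1`, and
the list of `v` occupies the cells from `arr 0 v` (included) to `arr 0 (v + 1)` (excluded).
Array `2` holds the weights. Everything else is `0`. -/
def initStore {n : ℕ} (adj : Fin n → List (Fin n)) (ω : Fin n → ℕ) : Store where
  reg x := if x = 0 then n else 0
  arr a i :=
    if a = 0 then (if i ≤ n then (((List.ofFn adj).take i).map List.length).sum else 0)
    else if a = 1 then ((List.ofFn adj).flatten.map Fin.val).getD i 0
    else if a = 2 then (if h : i < n then ω ⟨i, h⟩ else 0)
    else 0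

/-- The vertex set whose characteristic vector is in array `3`. -/
def outputSet (n : ℕ) (s : Store) : Finset (Fin n) :=
  Finset.univ.filter fun v => s.arr 3 v = 1

/-- The weighted efficient domination problem is robustly solvable in linear time on the graph
class `𝒞`. There is one program that, on every graph with `n` vertices, `m` edges and arbitrary
weights (in `𝒞` or not), halts within `O(n + m)` steps, on words of length `O(log (n + m + W))`,
`W` the largest weight. It answers in register `0`: `1` with an e.d. of minimum weight in
array `3`, or `0` and there is no e.d., or `2` and the graph is not in `𝒞`. -/
def WEDRobustlyLinearTime (𝒞 : ∀ n : ℕ, SimpleGraph (Fin n) → Prop) : Prop :=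
  ∃ (P : Prog) (c : ℕ), ∀ (n : ℕ) (G : SimpleGraph (Fin n)) (ω : Fin n → ℕ)
    (adj : Fin n → List (Fin n)), IsAdjLists G adj →
    ∃ (t : ℕ) (s : Store),
      Exec (c * (n + G.edgeSet.ncard + Finset.univ.sup ω + 1)) P (initStore adj ω) t s ∧
      t ≤ c * (n + G.edgeSet.ncard) + c ∧
      ((s.reg 0 = 1 ∧ IsMinWeightED G ω (outputSet n s)) ∨
        (s.reg 0 = 0 ∧ ¬ ∃ D : Set (Fin n), IsED G D) ∨
        (s.reg 0 = 2 ∧ ¬ 𝒞 n G))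

/-- The efficient domination problem (does an e.d. exist?) is robustly solvable in linear time on
the graph class `𝒞`. As for the weighted problem, without weights in the input, and with answers
`1`: there is an e.d., `0`: there is none, `2`: the graph is not in `𝒞`. -/
def EDRobustlyLinearTime (𝒞 : ∀ n : ℕ, SimpleGraph (Fin n) → Prop) : Prop :=
  ∃ (P : Prog) (c : ℕ), ∀ (n : ℕ) (G : SimpleGraph (Fin n))
    (adj : Fin n → List (Fin n)), IsAdjLists G adj →
    ∃ (t : ℕ) (s : Store),
      Exec (c * (n + G.edgeSet.ncard + 1)) P (initStore adj (fun _ => 0)) t s ∧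
      t ≤ c * (n + G.edgeSet.ncard) + c ∧
      ((s.reg 0 = 1 ∧ ∃ D : Set (Fin n), IsED G D) ∨
        (s.reg 0 = 0 ∧ ¬ ∃ D : Set (Fin n), IsED G D) ∨
        (s.reg 0 = 2 ∧ ¬ 𝒞 n G))

end EffDom

namespace EffDom

/-! ### Efficient dominating sets, homogeneous sets and thin spiders -/

section GraphTheory

variable {V : Type*} {G : SimpleGraph V}

/-! Structure. Let `D` be an e.d. of a `2P₂`-free graph, and let x, y be neighbours of different
members d, e of `D`. Since `D` is independent and no vertex has two neighbours in `D`, the edges dx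
and ey would induce a `2P₂` unless x and y were adjacent. So the sets N(d) are pairwise completely
joined (`IsED.adj_of_adj`), and each N(d) with at least two vertices is homogeneous. In a connected
prime graph every N(d) is therefore a single vertex, which gives a thin spider with independent part
`D`. In the general case `D` avoids all homogeneous sets (`IsED.notMem_of_isHomogeneous`), so each
N(d) is a maximal homogeneous set or a single vertex outside all homogeneous sets, and a
characteristic set meets it exactly once. Conversely, a vertex outside `I` has the same neighbours
in `I` as its representative in `C`, so `I` is an e.d.; it is the only one by `IsED.eq_of_joined`.

Algorithm. Isolated vertices belong to every e.d. If some hub dominates all other vertices, the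
e.d.s are exactly the sets consisting of one hub and the isolated vertices, and a lightest hub is
optimal. Otherwise take a non-isolated vertex v of minimum degree. For each neighbour u of v, look
for some w in `farCore G v` not adjacent to u. If w has a neighbour b far from v and not adjacent to
u, then vu and wb induce a `2P₂`. If there is no such b, or no such w at all, then u is in no e.d.
(`IsED.notMem_of_farCore`). Once all neighbours are excluded, v must dominate itself, and the other
members avoid N[v] and N(x) for a fixed neighbour x of v. This leaves a set `S`, independent unless
there is an induced `2P₂`, and `{v} ∪ S` is the only candidate (`IsED.eq_insert`). Counting
dominators decides whether it is an e.d.; no step relies on `2P₂`-freeness of the input.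

A round for one u costs a constant times the number of non-isolated vertices. There are deg v
rounds, so minimality of deg v bounds the total by a constant times the degree sum
(`mul_coreSize_le`). Time and correctness are proved together with `Runs`, while `Agree` records
what a program leaves untouched. -/

theorem TwoPTwoFree.not_of_adj (hG : TwoPTwoFree G) {a b c d : V} (hab : G.Adj a b)
    (hcd : G.Adj c d) (hac : ¬ G.Adj a c) (had : ¬ G.Adj a d) (hbc : ¬ G.Adj b c)
    (hbd : ¬ G.Adj b d) : False := by
  apply hG
  -- The four vertices are distinct because of the missing edges: a = c, for instance, would make a
  -- adjacent to d.
  have h1 : a ≠ c := fun h => had (h ▸ hcd)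
  have h2 : a ≠ d := fun h => hac (h ▸ hcd.symm)
  have h3 : b ≠ c := fun h => hbd (h ▸ hcd)
  have h4 : b ≠ d := fun h => hbc (h ▸ hcd.symm)
  have h5 := hab.ne
  have h6 := hcd.ne
  have hinj : Function.Injective (Sum.elim ![a, b] ![c, d]) := by
    rintro (x | x) (y | y) <;> fin_cases x <;> fin_cases y <;>
      simp [h1, h2, h3, h4, h5, h6, h1.symm, h2.symm, h3.symm, h4.symm, h5.symm, h6.symm]
  have hadj : ∀ p q : Fin 2 ⊕ Fin 2, G.Adj (Sum.elim ![a, b] ![c, d] p)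
      (Sum.elim ![a, b] ![c, d] q) ↔
        (SimpleGraph.sum (SimpleGraph.pathGraph 2) (SimpleGraph.pathGraph 2)).Adj p q := by
    rintro (x | x) (y | y) <;> fin_cases x <;> fin_cases y <;>
      simp [SimpleGraph.pathGraph_adj, hab, hcd, hac, had, hbc, hbd, hab.symm, hcd.symm,
        G.adj_comm c, G.adj_comm d]
  exact ⟨⟨⟨_, hinj⟩, hadj _ _⟩⟩

theorem IsED.exists_dominates {D : Set V} (hD : IsED G D) (v : V) :
    ∃ d ∈ D, Dominates G d v := by
  obtain ⟨d, hd, -⟩ := hD v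
  exact ⟨d, hd⟩

theorem IsED.eq_of_dominates {D : Set V} (hD : IsED G D) {v d e : V} (hd : d ∈ D) (he : e ∈ D)
    (h1 : Dominates G d v) (h2 : Dominates G e v) : d = e :=
  (hD v).unique ⟨hd, h1⟩ ⟨he, h2⟩

theorem IsED.not_adj {D : Set V} (hD : IsED G D) {d e : V} (hd : d ∈ D) (he : e ∈ D) :
    ¬ G.Adj d e := fun h =>
  h.ne (hD.eq_of_dominates hd he (Or.inr h) (Or.inl rfl))

theorem IsED.eq_of_adj {D : Set V} (hD : IsED G D) {v d e : V} (hd : d ∈ D) (he : e ∈ D)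
    (h1 : G.Adj d v) (h2 : G.Adj e v) : d = e :=
  hD.eq_of_dominates hd he (Or.inr h1) (Or.inr h2)

/-- In a `2P₂`-free graph the neighbourhoods of different members of an efficient dominating set
are completely joined. -/
theorem IsED.adj_of_adj {D : Set V} (hD : IsED G D) (hG : TwoPTwoFree G) {d e x y : V}
    (hd : d ∈ D) (he : e ∈ D) (hde : d ≠ e) (hx : G.Adj d x) (hy : G.Adj e y) : G.Adj x y := by
  by_contra hxy
  exact hG.not_of_adj hx hy (hD.not_adj hd he) (fun h => hde (hD.eq_of_adj hd he h hy))
    (fun h => hde (hD.eq_of_adj hd he hx h.symm)) hxy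

/-- A vertex outside N(d) is d, another member of `D`, or a neighbour of another member. It is
adjacent to all, none, and all of N(d), respectively. -/
theorem IsED.isHomogeneous_neighborSet {D : Set V} (hD : IsED G D) (hG : TwoPTwoFree G) {d : V}
    (hd : d ∈ D) (hN : (G.neighborSet d).Nontrivial) : IsHomogeneous G (G.neighborSet d) := by
  refine ⟨hN, fun h => ?_, fun v hv => ?_⟩
  · have : d ∈ G.neighborSet d := h ▸ Set.mem_univ d
    exact G.loopless.irrefl d this
  · obtain ⟨e, he, rfl | hev⟩ := hD.exists_dominates v
    · by_cases hde : d = e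
      · exact Or.inl fun h hh => hde ▸ hh
      · exact Or.inr fun h hh h' => hde (hD.eq_of_adj hd he hh h')
    · have hde : d ≠ e := fun h => hv (h ▸ hev)
      exact Or.inl fun h hh => (hD.adj_of_adj hG hd he hde hh hev).symm

theorem exists_adj_of_connected [Nontrivial V] (hG : G.Connected) (v : V) : ∃ u, G.Adj v u := by
  obtain ⟨u, hu⟩ := exists_ne v
  obtain ⟨w⟩ := hG.preconnected v u
  cases w with
  | nil => exact absurd rfl hu
  | cons h _ => exact ⟨_, h⟩

theorem IsThinSpiderPartition.mem_or_mem {C I : Set V} (h : IsThinSpiderPartition G C I) (v : V) :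
    v ∈ C ∨ v ∈ I := by
  have : v ∈ C ⊔ I := h.isCompl.sup_eq_top ▸ Set.mem_univ v
  exact this

theorem IsThinSpiderPartition.isED {C I : Set V} (h : IsThinSpiderPartition G C I) :
    IsED G I := by
  intro v
  rcases h.mem_or_mem v with hv | hv
  · obtain ⟨i, ⟨hi, hvi⟩, hu⟩ := h.existsUnique_right v hv
    refine ⟨i, ⟨hi, Or.inr hvi.symm⟩, ?_⟩
    rintro j ⟨hj, rfl | hjv⟩
    · exact absurd hj (Set.disjoint_left.1 h.isCompl.disjoint hv)
    · exact hu j ⟨hj, hjv.symm⟩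
  · refine ⟨v, ⟨hv, Or.inl rfl⟩, ?_⟩
    rintro j ⟨hj, rfl | hjv⟩
    · rfl
    · exact absurd hjv (h.isIndepSet hj hv hjv.ne)

theorem isED_iff_isThinSpider [Nontrivial V] (hc : G.Connected) (hp : IsPrimeGraph G)
    (hG : TwoPTwoFree G) : (∃ D : Set V, IsED G D) ↔ IsThinSpider G := by
  refine ⟨?_, fun ⟨C, I, h⟩ => ⟨I, h.isED⟩⟩
  rintro ⟨D, hD⟩
  have hsub : ∀ d ∈ D, (G.neighborSet d).Subsingleton := fun d hd =>
    Set.not_nontrivial_iff.1 fun h => hp _ (hD.isHomogeneous_neighborSet hG hd h)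
  have hdom : ∀ c ∈ Dᶜ, ∃ d ∈ D, G.Adj d c := by
    intro c hcD
    obtain ⟨d, hd, rfl | h⟩ := hD.exists_dominates c
    · exact absurd hd hcD
    · exact ⟨d, hd, h⟩
  refine ⟨Dᶜ, D, isCompl_compl.symm, ?_, ?_, ?_, ?_⟩
  · intro a ha b hb hab
    obtain ⟨d, hd, hda⟩ := hdom a ha
    obtain ⟨e, he, heb⟩ := hdom b hb
    refine hD.adj_of_adj hG hd he ?_ hda heb
    rintro rfl
    exact hab (hsub d hd hda heb)
  · exact fun d hd e he _ => hD.not_adj hd he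
  · intro c hcD
    obtain ⟨d, hd, hdc⟩ := hdom c hcD
    exact ⟨d, ⟨hd, hdc.symm⟩, fun e he => hD.eq_of_adj he.1 hd he.2.symm hdc⟩
  · intro d hd
    obtain ⟨c, hdc⟩ := exists_adj_of_connected hc d
    exact ⟨c, ⟨fun h => hD.not_adj hd h hdc, hdc⟩, fun e he => hsub d hd he.2 hdc⟩

theorem IsHomogeneous.adj_iff {H : Set V} (h : IsHomogeneous G H) {v a b : V} (hv : v ∉ H)
    (ha : a ∈ H) (hb : b ∈ H) : G.Adj v a ↔ G.Adj v b := by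
  rcases h.2.2 v hv with h | h
  · exact ⟨fun _ => h b hb, fun _ => h a ha⟩
  · exact ⟨fun h' => absurd h' (h a ha), fun h' => absurd h' (h b hb)⟩

theorem exists_isMaxHomogeneous [Finite V] {H : Set V} (h : IsHomogeneous G H) :
    ∃ H', H ⊆ H' ∧ IsMaxHomogeneous G H' :=
  (Set.toFinite {H | IsHomogeneous G H}).exists_le_maximal h

/-- An efficient dominating set with at least two members whose neighbourhoods are nonempty and
completely joined is the only one. -/
theorem IsED.eq_of_joined {D E : Set V} (hD : IsED G D) (hE : IsED G E)
    (hne : ∀ d ∈ D, ∃ x, G.Adj d x) (htwo : ∀ d ∈ D, ∃ e ∈ D, e ≠ d)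
    (hj : ∀ d ∈ D, ∀ e ∈ D, d ≠ e → ∀ x y, G.Adj d x → G.Adj e y → G.Adj x y) : E = D := by
  -- Suppose x in `E` is a neighbour of d in `D`. Take another e in `D`, and f in `E` dominating it.
  -- If f = e, then x and e share every neighbour y of e, so x = e is in `D`. If f is a neighbour of
  -- e, it is joined to x, although both are in `E`.
  have hsub : E ⊆ D := by
    intro x hx
    by_contra hxD
    obtain ⟨d, hd, rfl | hdx⟩ := hD.exists_dominates x
    · exact hxD hd
    obtain ⟨e, he, hed⟩ := htwo d hd
    obtain ⟨f, hf, hfe⟩ := hE.exists_dominates e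
    rcases hfe with rfl | hfe
    · obtain ⟨y, hy⟩ := hne f he
      have := hE.eq_of_adj hx hf (hj d hd f he hed.symm x y hdx hy) hy
      exact hxD (this ▸ he)
    · exact hE.not_adj hx hf (hj d hd e he hed.symm x f hdx hfe.symm)
  refine hsub.antisymm fun d hd => ?_
  obtain ⟨e, he, rfl | hed⟩ := hE.exists_dominates d
  · exact he
  · exact absurd hed (hD.not_adj (hsub he) hd)

theorem exists_not_adj_of_compl_connected [Nontrivial V] (hc : Gᶜ.Connected) (v : V) :
    ∃ u, u ≠ v ∧ ¬ G.Adj v u := by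
  obtain ⟨u, hu⟩ := exists_adj_of_connected hc v
  rw [SimpleGraph.compl_adj] at hu
  exact ⟨u, hu.1.symm, hu.2⟩

/-- As the complement is connected, d has a non-neighbour, which something other than d must
dominate. -/
theorem IsED.exists_ne [Nontrivial V] (hc : Gᶜ.Connected) {D : Set V} (hD : IsED G D) (d : V) :
    ∃ e ∈ D, e ≠ d := by
  obtain ⟨u, hu, hdu⟩ := exists_not_adj_of_compl_connected hc d
  obtain ⟨e, he, h⟩ := hD.exists_dominates u
  refine ⟨e, he, ?_⟩
  rintro rfl
  rcases h with rfl | h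
  · exact hu rfl
  · exact hdu h

/-- Since `I` avoids homogeneous sets, passing from a vertex to the representative of its maximal
homogeneous set does not change adjacency to `I`; domination is thus inherited from the spider. For
uniqueness, the clique `C` makes the neighbourhoods of different members of `I` completely joined.
-/
theorem isED_iff_of_isCharacteristicSpider [Finite V] [Nontrivial V] {R I : Set V}
    (hc : G.Connected) (hcc : Gᶜ.Connected) (hR : IsCharacteristicSet G R)
    (hI : IsCharacteristicSpider G R I) (D : Set V) : IsED G D ↔ D = I := by
  obtain ⟨⟨C, J, hs, rfl⟩, hhom⟩ := hI
  have hJ := hs.isED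
  -- every vertex is a member of `R`, or has the same neighbours in `I` as its representative
  have hrep : ∀ v, v ∈ R ∨ ∃ H, IsHomogeneous G H ∧ v ∈ H ∧ ∃ h : R, h ∈ C ∧ h.1 ∈ H ∧
      ∀ g ∈ R, g ∈ H → g = h.1 := by
    intro v
    by_cases hv : ∀ H, IsHomogeneous G H → v ∉ H
    · exact Or.inl (hR.1 v hv)
    · push Not at hv
      obtain ⟨H, hH, hvH⟩ := hv
      obtain ⟨M, hHM, hM⟩ := exists_isMaxHomogeneous hH
      obtain ⟨h, ⟨hhR, hhM⟩, hu⟩ := hR.2 M hM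
      refine Or.inr ⟨M, hM.1, hHM hvH, ⟨h, hhR⟩, ?_, hhM, fun g h1 h2 => hu g ⟨h1, h2⟩⟩
      exact (hs.mem_or_mem _).resolve_right fun h' => hhom h ⟨_, h', rfl⟩ M hM.1 hhM
  have hrep' : ∀ v, v ∉ Subtype.val '' J → ∃ h : R, h ∈ C ∧
      (∀ j ∈ J, G.Adj v j.1 ↔ G.Adj h.1 j.1) ∧ (v = h.1 ∨ ∃ H, IsHomogeneous G H ∧ v ∈ H ∧
        h.1 ∈ H ∧ ∀ g ∈ R, g ∈ H → g = h.1) := by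
    intro v hv
    rcases hrep v with hvR | ⟨H, hH, hvH, h, hhC, hhH, hu⟩
    · exact ⟨⟨v, hvR⟩, (hs.mem_or_mem _).resolve_right fun h => hv ⟨_, h, rfl⟩,
        fun _ _ => Iff.rfl, Or.inl rfl⟩
    · refine ⟨h, hhC, fun j hj => ?_, Or.inr ⟨H, hH, hvH, hhH, hu⟩⟩
      rw [G.adj_comm, G.adj_comm h.1]
      exact hH.adj_iff (hhom _ ⟨j, hj, rfl⟩ H hH) hvH hhH
  have hED : IsED G (Subtype.val '' J) := by
    intro v
    by_cases hv : v ∈ Subtype.val '' J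
    · obtain ⟨j, hj, rfl⟩ := hv
      refine ⟨j, ⟨⟨j, hj, rfl⟩, Or.inl rfl⟩, ?_⟩
      rintro _ ⟨⟨i, hi, rfl⟩, h | h⟩
      · exact h
      · exact absurd h (hJ.not_adj hi hj)
    · obtain ⟨h, hhC, hadj, -⟩ := hrep' v hv
      obtain ⟨j, ⟨hj, hhj⟩, hu⟩ := hs.existsUnique_right h hhC
      refine ⟨j, ⟨⟨j, hj, rfl⟩, Or.inr ((hadj j hj).2 hhj).symm⟩, ?_⟩
      rintro _ ⟨⟨i, hi, rfl⟩, rfl | h'⟩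
      · exact absurd ⟨i, hi, rfl⟩ hv
      · exact congrArg Subtype.val (hu i ⟨hi, (hadj i hi).1 h'.symm⟩)
  refine ⟨fun hD => ?_, fun h => h ▸ hED⟩
  refine hED.eq_of_joined hD (fun d _ => exists_adj_of_connected hc d)
    (fun d _ => hED.exists_ne hcc d) ?_
  rintro _ ⟨i, hi, rfl⟩ _ ⟨j, hj, rfl⟩ hij x y hix hjy
  obtain ⟨g, hgC, hg, hg'⟩ := hrep' x fun h => hED.not_adj ⟨i, hi, rfl⟩ h hix
  obtain ⟨h, hhC, hh, hh'⟩ := hrep' y fun h => hED.not_adj ⟨j, hj, rfl⟩ h hjy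
  have hne : g ≠ h := by
    rintro rfl
    exact hij (hED.eq_of_adj ⟨i, hi, rfl⟩ ⟨j, hj, rfl⟩ ((hg i hi).1 hix.symm).symm
      ((hh j hj).1 hjy.symm).symm)
  have hgh : G.Adj g.1 h.1 := hs.isClique hgC hhC hne
  have hne' : g.1 ≠ h.1 := fun h => hne (Subtype.ext h)
  -- The edge between the representatives g and h is carried over to x and h, then to x and y. The
  -- first move is allowed because g is the only member of `R` in the homogeneous set of x.
  have hxh : G.Adj x h.1 := by
    rcases hg' with rfl | ⟨H, hH, hxH, hgH, hu⟩
    · exact hgh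
    · exact ((hH.adj_iff (fun h' => hne' (hu _ h.2 h').symm) hxH hgH).2 hgh.symm).symm
  rcases hh' with rfl | ⟨H, hH, hyH, hhH, hu⟩
  · exact hxh
  -- If x were in the homogeneous set of y, then j, which lies outside it and sees y, would also see
  -- x; but i is the only neighbour of x in the e.d.
  · refine (hH.adj_iff (fun hxH => hij ?_) hyH hhH).2 hxh
    have : G.Adj j.1 x := (hH.adj_iff (hhom _ ⟨j, hj, rfl⟩ H hH) hyH hxH).1 hjy
    exact hED.eq_of_adj ⟨i, hi, rfl⟩ ⟨j, hj, rfl⟩ hix this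

/-- If `G` and its complement are connected and `G` is `2P₂`-free, then no member of an efficient
dominating set lies in a homogeneous set. -/
theorem IsED.notMem_of_isHomogeneous [Nontrivial V] {D H : Set V} (hc : G.Connected)
    (hcc : Gᶜ.Connected) (hG : TwoPTwoFree G) (hD : IsED G D) (hH : IsHomogeneous G H) {d : V}
    (hd : d ∈ D) : d ∉ H := by
  intro hdH
  -- A vertex that distinguishes two elements of `H` lies in `H`. The rest of the proof uses this to
  -- make `H` swallow the whole graph.
  have key : ∀ {v a b : V}, a ∈ H → b ∈ H → G.Adj v a → ¬ G.Adj v b → v ∈ H := by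
    intro v a b ha hb hva hvb
    by_contra hv
    exact hvb ((hH.adj_iff hv ha hb).1 hva)
  have hno : ∀ {e f x : V}, e ∈ D → f ∈ D → e ≠ f → G.Adj e x → ¬ G.Adj f x :=
    fun he hf hef h1 h2 => hef (hD.eq_of_adj he hf h1 h2)
  -- Here e distinguishes y from d, so e is in `H`. Each neighbour of a member of `D` then
  -- distinguishes d from e or y from d, so it is in `H`, and so are the remaining members of `D`.
  have main : ∀ e ∈ D, e ≠ d → ∀ y ∈ H, G.Adj e y → False := by
    intro e he hed y hy hey
    have heH : e ∈ H := key hy hdH hey (hD.not_adj he hd)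
    have h1 : ∀ f ∈ D, ∀ z, G.Adj f z → z ∈ H := by
      intro f hf z hfz
      by_cases hfd : f = d
      · subst hfd
        exact key hdH heH hfz.symm fun h => hno hd he hed.symm hfz h.symm
      · by_cases hfe : f = e
        · subst hfe
          exact key heH hdH hfz.symm fun h => hno he hd hed hfz h.symm
        · exact key hy hdH (hD.adj_of_adj hG hf he hfe hfz hey)
            fun h => hno hf hd hfd hfz h.symm
    refine hH.2.1 (Set.eq_univ_of_forall fun v => ?_)
    obtain ⟨f, hf, rfl | hfv⟩ := hD.exists_dominates v
    · obtain ⟨z, hz⟩ := exists_adj_of_connected hc f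
      by_cases hfd : f = d
      · exact hfd ▸ hdH
      · exact key (h1 f hf z hz) hdH hz (hD.not_adj hf hd)
    · exact h1 f hf v hfv
  -- Any second element of `H` leads to the situation of `main`; if it is dominated by d itself,
  -- another member of `D` is supplied by connectedness of the complement.
  obtain ⟨h, hhH, hhd⟩ := hH.1.exists_ne d
  obtain ⟨e, he, h'⟩ := hD.exists_dominates h
  by_cases hed : e = d
  · subst hed
    rcases h' with rfl | h'
    · exact hhd rfl
    · obtain ⟨f, hf, hfe⟩ := hD.exists_ne hcc e
      obtain ⟨y, hfy⟩ := exists_adj_of_connected hc f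
      exact main f hf hfe y (key hhH hdH (hD.adj_of_adj hG he hf hfe.symm h' hfy).symm
        fun h => hno hf hd hfe hfy h.symm) hfy
  · rcases h' with rfl | h'
    · obtain ⟨y, hy⟩ := exists_adj_of_connected hc e
      exact main e he hed y (key hhH hdH hy.symm fun h => hno he hd hed hy h.symm) hy
    · exact main e he hed h hhH h'

theorem exists_isCharacteristicSpider [Finite V] [Nontrivial V] {R : Set V} (hc : G.Connected)
    (hcc : Gᶜ.Connected) (hR : IsCharacteristicSet G R) (hG : TwoPTwoFree G) {D : Set V}
    (hD : IsED G D) : IsCharacteristicSpider G R D := by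
  have hDH : ∀ d ∈ D, ∀ H, IsHomogeneous G H → d ∉ H :=
    fun d hd H hH => hD.notMem_of_isHomogeneous hc hcc hG hH hd
  have hDR : D ⊆ R := fun d hd => hR.1 d (hDH d hd)
  have hsub : ∀ d ∈ D, ∀ H, IsHomogeneous G H → ∀ x ∈ H, G.Adj d x → H ⊆ G.neighborSet d :=
    fun d hd H hH x hx hdx y hy => (hH.adj_iff (hDH d hd H hH) hx hy).1 hdx
  have hone : ∀ d ∈ D, ∃! c, c ∈ R ∧ G.Adj d c := by
    intro d hd
    by_cases hN : (G.neighborSet d).Nontrivial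
    · have hH := hD.isHomogeneous_neighborSet hG hd hN
      -- A larger homogeneous set would meet N(d) and miss d, so d would be adjacent to all of it.
      have hmax : IsMaxHomogeneous G (G.neighborSet d) := by
        refine ⟨hH, fun H hH' hle => ?_⟩
        obtain ⟨x, hx⟩ := hN.nonempty
        exact hsub d hd H hH' x (hle hx) hx
      exact hR.2 _ hmax
    · rw [Set.not_nontrivial_iff] at hN
      obtain ⟨x, hx⟩ := exists_adj_of_connected hc d
      -- A homogeneous set with x would be contained in N(d), which has only one vertex.
      refine ⟨x, ⟨hR.1 x fun H hH hxH => ?_, hx⟩, fun y hy => hN hy.2 hx⟩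
      exact (Set.not_nontrivial_iff.2 (hN.anti (hsub d hd H hH x hxH hx))) hH.1
  have hdom : ∀ c ∉ D, ∃ d ∈ D, G.Adj d c := by
    intro c hcD
    obtain ⟨d, hd, rfl | h⟩ := hD.exists_dominates c
    · exact absurd hd hcD
    · exact ⟨d, hd, h⟩
  refine ⟨⟨(Subtype.val ⁻¹' D)ᶜ, Subtype.val ⁻¹' D, ⟨isCompl_compl.symm, ?_, ?_, ?_, ?_⟩, ?_⟩, hDH⟩
  · intro a ha b hb hab
    obtain ⟨d, hd, hda⟩ := hdom a ha
    obtain ⟨e, he, heb⟩ := hdom b hb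
    refine hD.adj_of_adj hG hd he ?_ hda heb
    rintro rfl
    exact hab (Subtype.ext ((hone d hd).unique ⟨a.2, hda⟩ ⟨b.2, heb⟩))
  · exact fun d hd e he _ => hD.not_adj hd he
  · intro c hcD
    obtain ⟨d, hd, hdc⟩ := hdom c hcD
    exact ⟨⟨d, hDR hd⟩, ⟨hd, hdc.symm⟩,
      fun e he => Subtype.ext (hD.eq_of_adj he.1 hd (SimpleGraph.Adj.symm he.2) hdc)⟩
  · intro d hd
    obtain ⟨c, ⟨hcR, hdc⟩, hu⟩ := hone d hd
    exact ⟨⟨c, hcR⟩, ⟨fun h => hD.not_adj hd h hdc, hdc⟩,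
      fun e he => Subtype.ext (hu e ⟨e.2, he.2⟩)⟩
  · rw [Subtype.image_preimage_coe, Set.inter_eq_right.2 hDR]

end GraphTheory

end EffDom

namespace EffDom

/-! ### Hubs, excluded vertices and the only candidate -/

section Candidates

variable {V : Type*} {G : SimpleGraph V}

variable (G) in
/-- The vertices without neighbours. -/
def isolated : Set V := {v | ∀ u, ¬ G.Adj v u}

variable (G) in
/-- `z` is not isolated, and it dominates all vertices that are not isolated. -/
def IsHub (z : V) : Prop := z ∉ isolated G ∧ ∀ u, u ∉ isolated G → Dominates G z u

theorem notMem_isolated_of_adj {u v : V} (h : G.Adj u v) : u ∉ isolated G := fun h' => h' v h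

theorem eq_of_dominates_of_mem_isolated {d v : V} (hv : v ∈ isolated G) (h : Dominates G d v) :
    d = v := by
  rcases h with h | h
  · exact h
  · exact absurd h.symm (hv d)

theorem IsED.isolated_subset {D : Set V} (hD : IsED G D) : isolated G ⊆ D := by
  intro v hv
  obtain ⟨d, hd, h⟩ := hD.exists_dominates v
  exact eq_of_dominates_of_mem_isolated hv h ▸ hd

theorem isED_univ (h : ∀ v, v ∈ isolated G) : IsED G Set.univ := fun v =>
  ⟨v, ⟨trivial, Or.inl rfl⟩, fun _ hd => eq_of_dominates_of_mem_isolated (h v) hd.2⟩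

theorem IsHub.isED {z : V} (hz : IsHub G z) : IsED G (insert z (isolated G)) := by
  intro v
  by_cases hv : v ∈ isolated G
  · exact ⟨v, ⟨Or.inr hv, Or.inl rfl⟩, fun d hd => eq_of_dominates_of_mem_isolated hv hd.2⟩
  · refine ⟨z, ⟨Or.inl rfl, hz.2 v hv⟩, ?_⟩
    rintro d ⟨rfl | hd, h⟩
    · rfl
    · rcases h with rfl | h
      · exact absurd hd hv
      · exact absurd h (hd v)

/-- Every non-isolated member of `D` dominates z, by symmetry of domination, so there is just one,
and it has to dominate all non-isolated vertices. -/
theorem IsHub.eq_insert_of_isED {z : V} (hz : IsHub G z) {D : Set V} (hD : IsED G D) :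
    ∃ d, IsHub G d ∧ D = insert d (isolated G) := by
  obtain ⟨d, hd, hdz⟩ := hD.exists_dominates z
  have hdi : d ∉ isolated G := by
    rcases hdz with rfl | hdz
    · exact hz.1
    · exact notMem_isolated_of_adj hdz
  have huniq : ∀ e ∈ D, e ∉ isolated G → e = d := by
    intro e he hei
    refine hD.eq_of_dominates he hd ?_ hdz
    rcases hz.2 e hei with h | h
    · exact Or.inl h.symm
    · exact Or.inr h.symm
  refine ⟨d, ⟨hdi, fun u hu => ?_⟩, Set.Subset.antisymm (fun e he => ?_) ?_⟩
  · obtain ⟨e, he, h⟩ := hD.exists_dominates u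
    have hei : e ∉ isolated G := by
      rcases h with rfl | h
      · exact hu
      · exact notMem_isolated_of_adj h
    exact huniq e he hei ▸ h
  · by_cases hei : e ∈ isolated G
    · exact Or.inr hei
    · exact Or.inl (huniq e he hei)
  · rintro e (rfl | he)
    · exact hd
    · exact hD.isolated_subset he

variable (G) in
/-- The vertices not dominated by `v`. -/
def far (v : V) : Set V := {a | ¬ Dominates G v a}

variable (G) in
/-- The vertices not dominated by `v` that have a neighbour not dominated by `v`. -/
def farCore (v : V) : Set V := {a | a ∈ far G v ∧ ∃ b ∈ far G v, G.Adj a b}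

/-- Otherwise vu and wb would induce a `2P₂`. This is both the certificate for a negative answer and
the reason why the candidate is independent. -/
theorem TwoPTwoFree.adj_of_mem_far (hG : TwoPTwoFree G) {v u w b : V} (hvu : G.Adj v u)
    (hw : w ∈ far G v) (hb : b ∈ far G v) (hwb : G.Adj w b) (huw : ¬ G.Adj u w) : G.Adj u b := by
  by_contra hub
  exact hG.not_of_adj hvu hwb (fun h => hw (Or.inr h)) (fun h => hb (Or.inr h)) huw hub

/-- Let `u` be a neighbour of `v` that is no hub, and let no `d` have its neighbourhood inside
`N(v) \ {u}`. If some vertex of `farCore G v` is not adjacent to `u`, let there be one whose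
neighbours far from `v` are all adjacent to `u`. Then `u` is in no efficient dominating set. -/
theorem IsED.notMem_of_farCore {D : Set V} (hD : IsED G D) {v u : V}
    (hu : ¬ IsHub G u) (hvu : G.Adj v u)
    (hdeg : ∀ d, d ∉ isolated G → ¬ G.neighborSet d ⊆ G.neighborSet v \ {u})
    (hcov : (∃ w ∈ farCore G v, ¬ G.Adj u w) →
      ∃ w ∈ farCore G v, ¬ G.Adj u w ∧ ∀ b ∈ far G v, G.Adj w b → G.Adj u b) : u ∉ D := by
  intro huD
  have hui : u ∉ isolated G := notMem_isolated_of_adj hvu.symm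
  have hx : ∃ x, x ∉ isolated G ∧ ¬ Dominates G u x := by
    by_contra hcon
    push Not at hcon
    exact hu ⟨hui, hcon⟩
  obtain ⟨x, hxi, hux⟩ := hx
  obtain ⟨d, hd, hdx⟩ := hD.exists_dominates x
  have hdu : d ≠ u := by rintro rfl; exact hux hdx
  have hdi : d ∉ isolated G := by
    rcases hdx with rfl | h
    · exact hxi
    · exact notMem_isolated_of_adj h
  have hfar : ∀ d ∈ D, d ≠ u → d ∈ far G v := by
    rintro d hd hdu (rfl | h)
    · exact hD.not_adj hd huD hvu
    · exact hdu (hD.eq_of_adj hd huD h.symm hvu.symm)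
  -- If all neighbours of d were neighbours of v, then N(d) would be inside N(v) without u, against
  -- `hdeg`. With such a y, the vertex d is in `farCore G v`.
  have hy : ∃ y, G.Adj d y ∧ ¬ G.Adj v y := by
    by_contra hcon
    push Not at hcon
    refine hdeg d hdi fun y hy => ⟨hcon y hy, ?_⟩
    rintro rfl
    exact hD.not_adj hd huD hy
  obtain ⟨y, hdy, hvy⟩ := hy
  have hyfar : y ∈ far G v := by
    rintro (rfl | h)
    · exact hdu (hD.eq_of_adj hd huD hdy hvu.symm)
    · exact hvy h
  obtain ⟨w, ⟨hw, c, hc, hwc⟩, huw, hall⟩ :=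
    hcov ⟨d, ⟨hfar d hd hdu, y, hyfar, hdy⟩, hD.not_adj huD hd⟩
  obtain ⟨e, he, hew⟩ := hD.exists_dominates w
  have heu : e ≠ u := by
    rintro rfl
    rcases hew with rfl | h
    · exact hw (Or.inr hvu)
    · exact huw h
  -- If w is in `D`, its far neighbour c has the two neighbours w and u in `D`. Otherwise the member
  -- e that dominates w is one of the far neighbours of w, hence adjacent to u in `D`.
  rcases hew with rfl | hew
  · exact heu (hD.eq_of_adj he huD hwc (hall c hc hwc))
  · exact hD.not_adj huD he (hall e (hfar e he heu) hew.symm)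

/-- If the set `S` of the vertices that are not dominated by `v` and not adjacent to its neighbour
`x` is independent, then `{v} ∪ S` is the only possible efficient dominating set with `v`. -/
theorem IsED.eq_insert {D S : Set V} (hD : IsED G D) {v x : V} (hv : v ∈ D) (hvx : G.Adj v x)
    (hS : ∀ a, a ∈ S ↔ ¬ Dominates G v a ∧ ¬ G.Adj x a) (hind : G.IsIndepSet S) :
    D = insert v S := by
  have hsub : D ⊆ insert v S := by
    intro d hd
    by_cases hdv : d = v
    · exact Or.inl hdv
    · refine Or.inr ((hS d).2 ⟨?_, fun h => hdv (hD.eq_of_adj hd hv h.symm hvx)⟩)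
      rintro (rfl | h)
      · exact hdv rfl
      · exact hD.not_adj hv hd h
  refine hsub.antisymm ?_
  rintro s (rfl | hs)
  · exact hv
  -- Neither v nor, by independence, another element of `S` dominates s, so s must be in `D` itself.
  · obtain ⟨d, hd, rfl | h⟩ := hD.exists_dominates s
    · exact hd
    · rcases hsub hd with rfl | hdS
      · exact absurd (Or.inr h) ((hS s).1 hs).1
      · exact absurd h (hind hdS hs h.ne)

theorem TwoPTwoFree.isIndepSet (hG : TwoPTwoFree G) {S : Set V} {v x : V} (hvx : G.Adj v x)
    (hS : ∀ a ∈ S, ¬ Dominates G v a ∧ ¬ G.Adj x a) : G.IsIndepSet S := by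
  intro a ha b hb _ hab
  exact (hS b hb).2 (hG.adj_of_mem_far hvx (hS a ha).1 (hS b hb).1 hab (hS a ha).2)

end Candidates

end EffDom

namespace EffDom

/-! ## Reasoning about programs -/

/-- The registers that an instruction can change. -/
def Instr.regs : Instr → List ℕ
  | const x _ | move x _ | add x _ _ | sub x _ _ | load x _ _ => [x]
  | write _ _ _ => []

/-- The arrays that an instruction can change. -/
def Instr.arrs : Instr → List ℕ
  | write a _ _ => [a]
  | _ => []

/-- The registers that a program can change. -/
def Prog.regs : Prog → List ℕ
  | skip => []
  | instr i => i.regs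
  | seq p q => p.regs ++ q.regs
  | branch _ _ p q => p.regs ++ q.regs
  | loop _ _ p => p.regs

/-- The arrays that a program can change. -/
def Prog.arrs : Prog → List ℕ
  | skip => []
  | instr i => i.arrs
  | seq p q => p.arrs ++ q.arrs
  | branch _ _ p q => p.arrs ++ q.arrs
  | loop _ _ p => p.arrs

/-- The memories agree on everything that the program cannot change. -/
structure Agree (P : Prog) (s s' : Store) : Prop where
  reg : ∀ x, x ∉ P.regs → s'.reg x = s.reg x
  arr : ∀ a, a ∉ P.arrs → s'.arr a = s.arr a

theorem Agree.refl (P : Prog) (s : Store) : Agree P s s := ⟨fun _ _ => rfl, fun _ _ => rfl⟩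

theorem Agree.trans {P : Prog} {s s' s'' : Store} (h : Agree P s s') (h' : Agree P s' s'') :
    Agree P s s'' :=
  ⟨fun x hx => (h'.reg x hx).trans (h.reg x hx), fun x hx => (h'.arr x hx).trans (h.arr x hx)⟩

theorem Agree.mono {P Q : Prog} {s s' : Store} (h : Agree P s s')
    (hr : ∀ x ∈ P.regs, x ∈ Q.regs) (ha : ∀ x ∈ P.arrs, x ∈ Q.arrs) : Agree Q s s' :=
  ⟨fun x hx => h.reg x fun h' => hx (hr x h'), fun x hx => h.arr x fun h' => hx (ha x h')⟩

/-- The frame rule. The lists of changeable registers and arrays are computed from the program text,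
so later side conditions are settled by `decide`. -/
theorem Exec.agree {w : ℕ} {P : Prog} {s s' : Store} {t : ℕ} (h : Exec w P s t s') :
    Agree P s s' := by
  induction h with
  | skip s => exact Agree.refl _ s
  | instr i s hi =>
    cases i <;> constructor <;> intro x hx <;>
      simp_all [Prog.regs, Prog.arrs, Instr.regs, Instr.arrs, Instr.apply]
  | seq _ _ h1 h2 =>
    exact (h1.mono (by simp +contextual [Prog.regs]) (by simp +contextual [Prog.arrs])).trans
      (h2.mono (by simp +contextual [Prog.regs]) (by simp +contextual [Prog.arrs]))
  | branch_true _ _ h1 =>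
    exact h1.mono (by simp +contextual [Prog.regs]) (by simp +contextual [Prog.arrs])
  | branch_false _ _ h1 =>
    exact h1.mono (by simp +contextual [Prog.regs]) (by simp +contextual [Prog.arrs])
  | loop_true _ _ _ h1 h2 =>
    exact (h1.mono (by simp [Prog.regs]) (by simp [Prog.arrs])).trans h2
  | loop_false _ => exact Agree.refl _ _

theorem Agree.apply {P : Prog} (s : Store) {i : Instr} (hr : ∀ x ∈ i.regs, x ∈ P.regs)
    (ha : ∀ x ∈ i.arrs, x ∈ P.arrs) : Agree P s (i.apply s) :=
  (Exec.instr i s le_rfl).agree.mono hr ha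

/-- Started in `s`, the program halts within `T` steps, and the final memory satisfies `Q`. -/
def Runs (w : ℕ) (P : Prog) (s : Store) (T : ℕ) (Q : Store → Prop) : Prop :=
  ∃ t s', Exec w P s t s' ∧ t ≤ T ∧ Q s'

namespace Runs

variable {w : ℕ} {P P' : Prog} {s : Store} {T T' : ℕ} {Q Q' : Store → Prop} {i : Instr} {x y : ℕ}

theorem mono (h : Runs w P s T Q) (hT : T ≤ T') (hQ : ∀ s', Agree P s s' → Q s' → Q' s') :
    Runs w P s T' Q' := by
  obtain ⟨t, s', h1, h2, h3⟩ := h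
  exact ⟨t, s', h1, h2.trans hT, hQ s' h1.agree h3⟩

theorem skip (h : Q s) : Runs w .skip s 1 Q := ⟨1, s, .skip s, le_rfl, h⟩

theorem instr (hw : i.value s ≤ w) (h : Q (i.apply s)) : Runs w (.instr i) s 1 Q :=
  ⟨1, _, .instr i s hw, le_rfl, h⟩

theorem seq (h : Runs w P s T Q) (h' : ∀ s', Agree P s s' → Q s' → Runs w P' s' T' Q') :
    Runs w (.seq P P') s (T + T') Q' := by
  obtain ⟨t, s', h1, h2, h3⟩ := h
  obtain ⟨t', s'', h1', h2', h3'⟩ := h' s' h1.agree h3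
  exact ⟨_, _, .seq h1 h1', by omega, h3'⟩

theorem step (hw : i.value s ≤ w) (h : Runs w P (i.apply s) T Q) :
    Runs w (.seq (.instr i) P) s (T + 1) Q := by
  obtain ⟨t, s', h1, h2, h3⟩ := h
  exact ⟨_, _, .seq (.instr i s hw) h1, by omega, h3⟩

theorem branch (h : s.reg x < s.reg y → Runs w P s T Q)
    (h' : ¬ s.reg x < s.reg y → Runs w P' s T Q) : Runs w (.branch x y P P') s (T + 1) Q := by
  by_cases hxy : s.reg x < s.reg y
  · obtain ⟨t, s', h1, h2, h3⟩ := h hxy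
    exact ⟨_, _, .branch_true hxy h1, by omega, h3⟩
  · obtain ⟨t, s', h1, h2, h3⟩ := h' hxy
    exact ⟨_, _, .branch_false hxy h1, by omega, h3⟩

theorem loop_of_lt (h : s.reg x < s.reg y) (hP : Runs w P s T Q)
    (hl : ∀ s', Agree P s s' → Q s' → Runs w (.loop x y P) s' T' Q') :
    Runs w (.loop x y P) s (T + T' + 1) Q' := by
  obtain ⟨t, s', h1, h2, h3⟩ := hP
  obtain ⟨t', s'', h1', h2', h3'⟩ := hl s' h1.agree h3
  exact ⟨_, _, .loop_true h h1 h1', by omega, h3'⟩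

theorem loop_of_not_lt (h : ¬ s.reg x < s.reg y) (hQ : Q s) : Runs w (.loop x y P) s 1 Q :=
  ⟨1, s, .loop_false h, le_rfl, hQ⟩

/-- A counting loop: register `x` runs from `a` to `b`, and iteration `k` takes at most `f k`
steps. -/
theorem loop (Inv : ℕ → Store → Prop) (f : ℕ → ℕ) (a b : ℕ) (hab : a ≤ b) (h0 : Inv a s)
    (hx : s.reg x = a) (hy : s.reg y = b) (hyP : y ∉ P.regs)
    (hstep : ∀ k, a ≤ k → k < b → ∀ s', Agree P s s' → s'.reg x = k → Inv k s' →
      Runs w P s' (f k) fun s'' => s''.reg x = k + 1 ∧ Inv (k + 1) s'') :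
    Runs w (.loop x y P) s (∑ k ∈ Finset.Ico a b, (f k + 1) + 1) (Inv b) := by
  obtain ⟨d, rfl⟩ := Nat.exists_eq_add_of_le hab
  induction d generalizing a s with
  | zero =>
    refine (loop_of_not_lt (Q := Inv (a + 0)) (by omega) h0).mono (by simp) fun _ _ h => h
  | succ d ih =>
    have h1 := hstep a le_rfl (by omega) s (Agree.refl _ _) hx h0
    have h2 := loop_of_lt (Q' := Inv (a + (d + 1)))
      (T' := ∑ k ∈ Finset.Ico (a + 1) (a + 1 + d), (f k + 1) + 1) (x := x) (y := y) (by omega) h1 ?_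
    · refine h2.mono ?_ fun _ _ h => h
      rw [← Finset.sum_Ioo_add_eq_sum_Ico (a := a) (by omega)]
      have : Finset.Ioo a (a + (d + 1)) = Finset.Ico (a + 1) (a + 1 + d) := by
        ext; simp; omega
      rw [this]
      omega
    · rintro s' hs ⟨hx', hI⟩
      have := ih (s := s') (a + 1) hI hx' (by omega)
        (by rw [hs.reg y hyP, hy]; omega) ?_
      · have e : a + 1 + d = a + (d + 1) := by omega
        rw [e] at this ⊢
        exact this
      · intro k hk hk' s'' hs''
        exact hstep k (by omega) (by omega) s'' (hs.trans hs'')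

end Runs

/-- The condition does not depend on register `x`. -/
def Stable (x : ℕ) (Q : Store → Prop) : Prop :=
  ∀ s k, Q s → Q { s with reg := Function.update s.reg x k }

section Apply

variable (s : Store) (x y z k a b : ℕ)

@[simp] theorem reg_const : ((Instr.const x k).apply s).reg y = if y = x then k else s.reg y := by
  simp [Instr.apply, Instr.value, Function.update_apply]

@[simp] theorem reg_move :
    ((Instr.move x z).apply s).reg y = if y = x then s.reg z else s.reg y := by
  simp [Instr.apply, Instr.value, Function.update_apply]

@[simp] theorem reg_add :
    ((Instr.add x z k).apply s).reg y = if y = x then s.reg z + s.reg k else s.reg y := by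
  simp [Instr.apply, Instr.value, Function.update_apply]

@[simp] theorem reg_sub :
    ((Instr.sub x z k).apply s).reg y = if y = x then s.reg z - s.reg k else s.reg y := by
  simp [Instr.apply, Instr.value, Function.update_apply]

@[simp] theorem reg_load :
    ((Instr.load x a z).apply s).reg y = if y = x then s.arr a (s.reg z) else s.reg y := by
  simp [Instr.apply, Instr.value, Function.update_apply]

@[simp] theorem reg_write : ((Instr.write a x z).apply s).reg y = s.reg y := rfl

@[simp] theorem arr_const : ((Instr.const x k).apply s).arr a = s.arr a := rfl

@[simp] theorem arr_move : ((Instr.move x k).apply s).arr a = s.arr a := rfl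

@[simp] theorem arr_add : ((Instr.add x z k).apply s).arr a = s.arr a := rfl

@[simp] theorem arr_sub : ((Instr.sub x z k).apply s).arr a = s.arr a := rfl

@[simp] theorem arr_load : ((Instr.load x b k).apply s).arr a = s.arr a := rfl

@[simp] theorem arr_write :
    ((Instr.write b x z).apply s).arr a k =
      if a = b ∧ k = s.reg x then s.reg z else s.arr a k := by
  by_cases h : a = b
  · subst h
    simp [Instr.apply, Instr.value, Function.update_apply]
  · simp [Instr.apply, h]

end Apply

attribute [simp] Instr.value

end EffDom

namespace EffDom

/-! ## The input and its traversal -/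

section Input

variable {n : ℕ}

/-- The position at which the adjacency list of `k` starts. -/
def offset (adj : Fin n → List (Fin n)) (k : ℕ) : ℕ :=
  (((List.ofFn adj).take k).map List.length).sum

theorem offset_succ (adj : Fin n → List (Fin n)) (a : Fin n) :
    offset adj (a + 1) = offset adj a + (adj a).length := by
  simp [offset, List.take_add_one]

theorem offset_eq_sum (adj : Fin n → List (Fin n)) : offset adj n = ∑ a, (adj a).length := by
  rw [offset, List.take_of_length_le (by simp), List.map_ofFn, List.sum_ofFn]
  rfl

theorem offset_mono (adj : Fin n → List (Fin n)) {i j : ℕ} (h : i ≤ j) :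
    offset adj i ≤ offset adj j := by
  unfold offset
  obtain ⟨d, rfl⟩ := Nat.exists_eq_add_of_le h
  rw [List.take_add, List.map_append, List.sum_append]
  omega

/-- The offset of `a` is the total length of the lists before `adj a`, so the index points just
behind `l`. -/
theorem flatten_getD (adj : Fin n → List (Fin n)) (a b : Fin n) {l r : List (Fin n)}
    (h : adj a = l ++ b :: r) :
    ((List.ofFn adj).flatten.map Fin.val).getD (offset adj a + l.length) 0 = b := by
  have h1 : List.ofFn adj = (List.ofFn adj).take a ++ adj a :: (List.ofFn adj).drop (a + 1) := by
    conv_lhs => rw [← List.take_append_drop a (List.ofFn adj)]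
    rw [List.drop_eq_getElem_cons (by simp)]
    simp
  have h2 : offset adj a = ((List.ofFn adj).take a).flatten.length := by
    rw [offset, List.length_flatten]
  rw [h2]
  generalize (List.ofFn adj).take a = L at h1 ⊢
  generalize (List.ofFn adj).drop (a + 1) = M at h1
  have h3 : (List.ofFn adj).flatten.map Fin.val =
      (L.flatten ++ l).map Fin.val ++ b.val :: (r ++ M.flatten).map Fin.val := by simp [h1, h]
  have h4 : L.flatten.length + l.length = ((L.flatten ++ l).map Fin.val).length := by
    rw [List.length_map, List.length_append]
  rw [h3, h4, List.getD_eq_getElem?_getD, List.getElem?_append_right le_rfl]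
  simp

/-- The memory still contains the input, and registers `1` and `2` hold `1` and `0`. -/
structure Holds (adj : Fin n → List (Fin n)) (ω : Fin n → ℕ) (s : Store) : Prop where
  size : s.reg 0 = n
  one : s.reg 1 = 1
  zero : s.reg 2 = 0
  arr : ∀ a ∈ [0, 1, 2], s.arr a = (initStore adj ω).arr a

/-- The program does not change the input and the registers `1` and `2`. -/
abbrev Prog.Preserves (P : Prog) : Prop :=
  (∀ x ∈ [0, 1, 2], x ∉ P.regs) ∧ ∀ x ∈ [0, 1, 2], x ∉ P.arrs

variable {adj : Fin n → List (Fin n)} {ω : Fin n → ℕ} {s s' : Store} {P body : Prog}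

theorem Holds.agree (h : Holds adj ω s) (hs : Agree P s s') (hP : P.Preserves) :
    Holds adj ω s' where
  size := by rw [hs.reg 0 (hP.1 0 (by simp)), h.size]
  one := by rw [hs.reg 1 (hP.1 1 (by simp)), h.one]
  zero := by rw [hs.reg 2 (hP.1 2 (by simp)), h.zero]
  arr a ha := by rw [hs.arr a (hP.2 a ha), h.arr a ha]

theorem Holds.offset (h : Holds adj ω s) {k : ℕ} (hk : k ≤ n) :
    s.arr 0 k = offset adj k := by
  rw [h.arr 0 (by simp)]
  simp [initStore, hk, EffDom.offset]

theorem Holds.neighbor (h : Holds adj ω s) (a b : Fin n) {l r : List (Fin n)}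
    (hl : adj a = l ++ b :: r) : s.arr 1 (EffDom.offset adj a + l.length) = b := by
  rw [h.arr 1 (by simp), ← flatten_getD adj a b hl]
  simp [initStore]

theorem Holds.weight (h : Holds adj ω s) (a : Fin n) : s.arr 2 a = ω a := by
  rw [h.arr 2 (by simp)]
  simp [initStore]

/-- `for all vertices a do body`, with `a` in register `3` -/
def Prog.forVertices (body : Prog) : Prog :=
  .seq (.instr (.move 3 2)) (.loop 3 0 (.seq body (.instr (.add 3 3 1))))

/-- `for all neighbours b of a do body`, with `a` in register `src` at the beginning, and `b` in
register `j + 2` -/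
def Prog.forNeighbors (src j : ℕ) (body : Prog) : Prog :=
  .seq (.instr (.load j 0 src)) <| .seq (.instr (.add (j + 1) src 1)) <|
    .seq (.instr (.load (j + 1) 0 (j + 1))) <|
      .loop j (j + 1) (.seq (.instr (.load (j + 2) 1 j)) (.seq body (.instr (.add j j 1))))

/-- An iteration adds one test and one increment to the cost of the body. Stability lets the
invariant survive changes of the counter. -/
theorem Runs.forVertices {w : ℕ} (hs : Holds adj ω s) (hw : n ≤ w) (hP : body.Preserves)
    (h3 : 3 ∉ body.regs) (Inv : ℕ → Store → Prop) (hst : ∀ k, Stable 3 (Inv k)) (f : Fin n → ℕ)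
    (h0 : Inv 0 s)
    (hstep : ∀ (a : Fin n) (s' : Store), Agree (.forVertices body) s s' → Holds adj ω s' →
      s'.reg 3 = a → Inv a s' → Runs w body s' (f a) (Inv (a + 1))) :
    Runs w (.forVertices body) s (∑ a, (f a + 2) + 2) (Inv n) := by
  have hP' : (Prog.forVertices body).Preserves := by
    have h1 := hP.1
    have h2 := hP.2
    simp [Prog.Preserves, Prog.forVertices, Prog.regs, Prog.arrs, Instr.regs, Instr.arrs] at h1 h2 ⊢
    tauto
  have hzero : (s.reg 2) ≤ w := by rw [hs.zero]; omega
  refine (Runs.step hzero (T := ∑ a, (f a + 2) + 1) (Q := Inv n) ?_).mono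
    le_rfl fun _ _ h => h
  set s₁ := (Instr.move 3 2).apply s with hs₁
  have ha₁ : Agree (.forVertices body) s s₁ :=
    Agree.apply s (by simp [Prog.forVertices, Prog.regs, Instr.regs]) (by simp [Instr.arrs])
  have := Runs.loop (w := w) (P := .seq body (.instr (.add 3 3 1))) (x := 3) (y := 0) (s := s₁)
    Inv (fun k => if h : k < n then f ⟨k, h⟩ + 1 else 0) 0 n (Nat.zero_le _) (hst 0 _ _ h0)
    (by simp [hs₁, hs.zero])
    (by simp [hs₁, hs.size]) ?_ ?_
  · simpa [← Finset.range_eq_Ico, Finset.sum_range, Nat.add_assoc] using this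
  · have := hP.1 0 (by simp)
    simp [Prog.regs, Instr.regs, this]
  · intro k _ hk s₂ hs₂ hk₂ hI
    rw [dif_pos hk]
    have ha₂ : Agree (.forVertices body) s s₂ :=
      ha₁.trans (hs₂.mono (by simp +contextual [Prog.forVertices, Prog.regs])
        (by simp +contextual [Prog.forVertices, Prog.arrs]))
    have hs₂' := hs.agree ha₂ hP'
    refine (hstep ⟨k, hk⟩ s₂ ha₂ hs₂' hk₂ hI).seq fun s₃ hs₃ hI₃ => ?_
    have h3' := (hs₂'.agree hs₃ hP).one
    have hk₃ : s₃.reg 3 = k := by rw [hs₃.reg 3 h3, hk₂]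
    refine Runs.instr ?_ ⟨?_, hst _ _ _ hI₃⟩
    · simp only [Instr.value, hk₃, h3']
      omega
    · simp [hk₃, h3']

/-- The invariant is indexed by the part of the adjacency list already visited. Each iteration adds
a load, an increment and a test; the other 4 steps are the set-up and the last test. Register `src`
is read again after `j` has been overwritten, hence `src ≠ j`. -/
theorem Runs.forNeighbors {w src j : ℕ} (hs : Holds adj ω s) (hw : n + offset adj n ≤ w)
    {a : Fin n} (ha : s.reg src = a) (hj : 3 ≤ j) (hsrc : src ≠ j) (hP : body.Preserves)
    (hjb : j ∉ body.regs) (hjb' : j + 1 ∉ body.regs) (Inv : List (Fin n) → Store → Prop)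
    (hst : ∀ l, Stable j (Inv l)) (hst₁ : ∀ l, Stable (j + 1) (Inv l))
    (hst₂ : ∀ l, Stable (j + 2) (Inv l)) (T : ℕ) (h0 : Inv [] s)
    (hstep : ∀ (l : List (Fin n)) (b : Fin n) (r : List (Fin n)), adj a = l ++ b :: r →
      ∀ s' : Store, Agree (.forNeighbors src j body) s s' →
      Holds adj ω s' → s'.reg (j + 2) = b → Inv l s' → Runs w body s' T (Inv (l ++ [b]))) :
    Runs w (.forNeighbors src j body) s ((adj a).length * (T + 3) + 4) (Inv (adj a)) := by
  have hP' : (Prog.forNeighbors src j body).Preserves := by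
    have h1 := hP.1
    have h2 := hP.2
    simp [Prog.Preserves, Prog.forNeighbors, Prog.regs, Prog.arrs, Instr.regs, Instr.arrs] at h1 h2 ⊢
    refine ⟨⟨?_, ?_, ?_⟩, h2⟩ <;> simp [h1] <;> omega
  have hoff := offset_succ adj a
  have hle := offset_mono adj (show a.1 + 1 ≤ n from a.2)
  have hv : s.arr 0 a = offset adj a := hs.offset a.2.le
  have hv' : s.arr 0 (a + 1) = offset adj (a + 1) := hs.offset a.2
  refine (Runs.step (T := (adj a).length * (T + 3) + 3) ?_ <|
    Runs.step (T := (adj a).length * (T + 3) + 2) ?_ <|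
    Runs.step (T := (adj a).length * (T + 3) + 1) ?_ ?_).mono le_rfl fun _ _ h => h
  · simp only [Instr.value, ha, hv]; omega
  · simp [hsrc, ha, hs.one, show 1 ≠ j by omega]; omega
  · simp [hsrc, ha, hs.one, hv', show 1 ≠ j by omega]; omega
  set s₁ := (Instr.load (j + 1) 0 (j + 1)).apply
    ((Instr.add (j + 1) src 1).apply ((Instr.load j 0 src).apply s)) with hs₁
  have ha₁ : Agree (.forNeighbors src j body) s s₁ := by
    refine ⟨fun x hx => ?_, fun b _ => by simp [hs₁]⟩
    simp [Prog.forNeighbors, Prog.regs, Instr.regs] at hx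
    simp [hs₁, hx]
  have h1 : s₁.reg j = offset adj a := by simp [hs₁, ha, hv]
  have h2 : s₁.reg (j + 1) = offset adj (a + 1) := by
    simp [hs₁, ha, hsrc, hs.one, hv', show 1 ≠ j by omega]
  have := Runs.loop (w := w)
    (P := .seq (.instr (.load (j + 2) 1 j)) (.seq body (.instr (.add j j 1)))) (x := j)
    (y := j + 1) (s := s₁) (fun k => Inv ((adj a).take (k - offset adj a))) (fun _ => T + 2)
    (offset adj a) (offset adj (a + 1)) (by omega) ?_ h1 h2 ?_ ?_
  · refine this.mono ?_ fun s' _ h => ?_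
    · simp [hoff]
    · simpa [hoff] using h
  · simpa using (show Inv [] s₁ from hst₁ _ _ _ (hst₁ _ _ _ (hst _ _ _ h0)))
  · simp [Prog.regs, Instr.regs, hjb']
  · intro k hk hk' s₂ hs₂ hk₂ hI
    obtain ⟨i, rfl⟩ := Nat.exists_eq_add_of_le hk
    have hi : i < (adj a).length := by omega
    have hsplit : adj a = (adj a).take i ++ (adj a)[i] :: (adj a).drop (i + 1) := by
      rw [List.getElem_cons_drop, List.take_append_drop]
    have ha₂ : Agree (.forNeighbors src j body) s s₂ :=
      ha₁.trans (hs₂.mono (by simp +contextual [Prog.forNeighbors, Prog.regs])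
        (by simp +contextual [Prog.forNeighbors, Prog.arrs]))
    have hs₂' := hs.agree ha₂ hP'
    have hb : s₂.arr 1 (s₂.reg j) = (adj a)[i] := by
      rw [hk₂]
      simpa [Nat.min_eq_left hi.le] using hs₂'.neighbor a _ hsplit
    rw [Nat.add_sub_cancel_left] at hI
    rw [Nat.add_assoc, Nat.add_sub_cancel_left, List.take_add_one, List.getElem?_eq_getElem hi]
    refine Runs.step (T := T + 1) ?_ ?_
    · simp only [Instr.value, hb]
      omega
    set s₃ := (Instr.load (j + 2) 1 j).apply s₂ with hs₃
    have ha₃ : Agree (.forNeighbors src j body) s₂ s₃ :=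
      Agree.apply s₂ (by simp [Prog.forNeighbors, Prog.regs, Instr.regs]) (by simp [Instr.arrs])
    have hs₃' := hs₂'.agree ha₃ hP'
    refine (hstep _ _ _ hsplit s₃ (ha₂.trans ha₃) hs₃' (by simp [hs₃, hb])
      (hst₂ _ _ _ hI)).seq fun s₄ hs₄ hI₄ => ?_
    have h4 := (hs₃'.agree hs₄ hP).one
    have hk₄ : s₄.reg j = offset adj a + i := by rw [hs₄.reg j hjb, ← hk₂]; simp [hs₃]
    refine Runs.instr ?_ ⟨?_, hst _ _ _ hI₄⟩
    · simp only [Instr.value, hk₄, h4]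
      omega
    · simp [hk₄, h4, Nat.add_assoc]

end Input

end EffDom

namespace EffDom

/-! ### Degrees, counting and the number of non-isolated vertices -/

section Degrees

variable {n : ℕ} {G : SimpleGraph (Fin n)} {adj : Fin n → List (Fin n)}

theorem IsAdjLists.mem_isolated_iff (h : IsAdjLists G adj) (a : Fin n) :
    a ∈ isolated G ↔ (adj a).length = 0 := by
  rw [List.length_eq_zero_iff, List.eq_nil_iff_forall_not_mem]
  simp only [(h a).2]
  rfl

theorem IsAdjLists.degree [DecidableRel G.Adj] (h : IsAdjLists G adj) (a : Fin n) :
    G.degree a = (adj a).length := by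
  rw [← List.toFinset_card_of_nodup (h a).1, ← SimpleGraph.card_neighborFinset_eq_degree]
  congr 1
  ext u
  simp [(h a).2]

theorem IsAdjLists.offset_eq (h : IsAdjLists G adj) : offset adj n = 2 * G.edgeSet.ncard := by
  classical
  rw [offset_eq_sum, Set.ncard_eq_toFinset_card', ← SimpleGraph.edgeFinset,
    ← G.sum_degrees_eq_twice_card_edges]
  exact Finset.sum_congr rfl fun a _ => (h.degree a).symm

open Classical in
/-- The number of vertices below `k` with property `p`. -/
noncomputable def countBelow (p : Fin n → Prop) (k : ℕ) : ℕ :=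
  (Finset.univ.filter fun a : Fin n => a.val < k ∧ p a).card

theorem countBelow_zero (p : Fin n → Prop) : countBelow p 0 = 0 := by simp [countBelow]

open Classical in
theorem countBelow_succ (p : Fin n → Prop) (a : Fin n) :
    countBelow p (a + 1) = countBelow p a + if p a then 1 else 0 := by
  unfold countBelow
  split_ifs with h
  · rw [← Finset.card_insert_of_notMem (a := a) (by simp)]
    congr 1
    ext b
    simp only [Finset.mem_filter, Finset.mem_univ, true_and, Finset.mem_insert]
    constructor
    · rintro ⟨h1, h2⟩
      by_cases hb : b = a
      · exact Or.inl hb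
      · exact Or.inr ⟨by omega, h2⟩
    · rintro (rfl | ⟨h1, h2⟩)
      · exact ⟨by omega, h⟩
      · exact ⟨by omega, h2⟩
  · rw [add_zero (Finset.card _)]
    refine congrArg Finset.card ?_
    ext b
    simp only [Finset.mem_filter, Finset.mem_univ, true_and]
    constructor
    · rintro ⟨h1, h2⟩
      have hb : b ≠ a := by rintro rfl; exact h h2
      exact ⟨by omega, h2⟩
    · rintro ⟨h1, h2⟩
      exact ⟨by omega, h2⟩

theorem countBelow_mono {p q : Fin n → Prop} (h : ∀ a, p a → q a) {k : ℕ} :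
    countBelow p k ≤ countBelow q k := by
  classical
  exact Finset.card_le_card fun a => by simpa using fun h1 h2 => ⟨h1, h a h2⟩

theorem countBelow_le (p : Fin n → Prop) (k : ℕ) : countBelow p k ≤ n := by
  classical
  exact (Finset.card_filter_le _ _).trans (by simp)

variable (G) in
/-- The number of vertices that are not isolated. -/
noncomputable def coreSize : ℕ := countBelow (fun a => a ∉ isolated G) n

theorem coreSize_eq_card [DecidablePred (· ∉ isolated G)] :
    coreSize G = (Finset.univ.filter fun a => a ∉ isolated G).card := by
  unfold coreSize countBelow
  congr 1
  ext
  simp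

open Classical in
theorem IsAdjLists.insert_subset (h : IsAdjLists G adj) {a : Fin n} (ha : a ∉ isolated G) :
    insert a (adj a).toFinset ⊆ Finset.univ.filter fun a => a ∉ isolated G := by
  intro b hb
  simp only [Finset.mem_insert, List.mem_toFinset, (h a).2] at hb
  simp only [Finset.mem_filter, Finset.mem_univ, true_and]
  rcases hb with rfl | hb
  · exact ha
  · exact notMem_isolated_of_adj hb.symm

open Classical in
theorem IsAdjLists.card_insert (h : IsAdjLists G adj) (a : Fin n) :
    (insert a (adj a).toFinset).card = (adj a).length + 1 := by
  rw [Finset.card_insert_of_notMem, List.toFinset_card_of_nodup (h a).1]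
  simp [(h a).2]

theorem IsAdjLists.length_lt_coreSize (h : IsAdjLists G adj) {a : Fin n} (ha : a ∉ isolated G) :
    (adj a).length < coreSize G := by
  classical
  have := Finset.card_le_card (h.insert_subset ha)
  rwa [h.card_insert, ← coreSize_eq_card] at this

theorem IsAdjLists.length_le_coreSize (h : IsAdjLists G adj) (a : Fin n) :
    (adj a).length ≤ coreSize G := by
  by_cases ha : a ∈ isolated G
  · rw [h.mem_isolated_iff] at ha
    omega
  · exact (h.length_lt_coreSize ha).le

theorem coreSize_le : coreSize G ≤ n := countBelow_le _ _

theorem IsAdjLists.length_lt (h : IsAdjLists G adj) (a : Fin n) : (adj a).length < n := by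
  have := h.length_le_coreSize a
  have := coreSize_le (G := G)
  by_cases ha : a ∈ isolated G
  · rw [h.mem_isolated_iff] at ha
    have := a.2
    omega
  · have := h.length_lt_coreSize ha
    omega

/-- The closed neighbourhood of a non-isolated vertex is contained in the set of non-isolated
vertices, so equality is a matter of cardinality. Degrees alone therefore detect hubs. -/
theorem IsAdjLists.isHub_iff (h : IsAdjLists G adj) (a : Fin n) :
    IsHub G a ↔ (adj a).length + 1 = coreSize G := by
  classical
  have key : ∀ u, u ∈ insert a (adj a).toFinset ↔ Dominates G a u := by
    intro u
    simp [(h a).2, Dominates, eq_comm]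
  constructor
  · intro ha
    rw [← h.card_insert, coreSize_eq_card]
    congr 1
    refine (h.insert_subset ha.1).antisymm fun u hu => ?_
    rw [key]
    exact ha.2 u (by simpa using hu)
  · intro ha
    -- An isolated `a` would leave exactly one non-isolated vertex, which could have no neighbour.
    have hai : a ∉ isolated G := by
      intro hai
      rw [h.mem_isolated_iff] at hai
      rw [hai, coreSize_eq_card, eq_comm, Finset.card_eq_one] at ha
      obtain ⟨b, hb⟩ := ha
      have hb' : b ∉ isolated G := by
        have : b ∈ Finset.univ.filter fun a => a ∉ isolated G := by rw [hb]; simp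
        simpa using this
      have := h.length_lt_coreSize hb'
      rw [coreSize_eq_card, hb, Finset.card_singleton] at this
      exact hb' ((h.mem_isolated_iff b).2 (by omega))
    refine ⟨hai, fun u hu => ?_⟩
    rw [← key, Finset.eq_of_subset_of_card_le (h.insert_subset hai)
      (by rw [h.card_insert, ← coreSize_eq_card, ha])]
    simpa using hu

/-- Each non-isolated vertex contributes at least `d` to the degree sum. This pays for `d` rounds
that each cost as much as the number of non-isolated vertices. -/
theorem mul_coreSize_le {d : ℕ}
    (hd : ∀ a, a ∉ isolated G → d ≤ (adj a).length) : d * coreSize G ≤ offset adj n := by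
  classical
  rw [offset_eq_sum, coreSize_eq_card, mul_comm, ← smul_eq_mul]
  refine (Finset.card_nsmul_le_sum _ (fun a => (adj a).length) d fun a ha => ?_).trans
    (Finset.sum_le_sum_of_subset (Finset.subset_univ _))
  exact hd a (by simpa using ha)

end Degrees

/-! ## The program -/

namespace Prog

infixr:60 " ⟫ " => Prog.seq

/-- Register `16` becomes the degree of the vertex in register `3`. -/
def loadDegree : Prog :=
  .instr (.load 4 0 3) ⟫ .instr (.add 5 3 1) ⟫ .instr (.load 5 0 5) ⟫ .instr (.sub 16 5 4)

/-- Marks the isolated vertices in array `3`, counts the others in register `10`, and finds one of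
minimum degree (register `12`, its degree in register `11`). -/
def scanDegrees : Prog :=
  forVertices <| loadDegree ⟫
    branch 2 16
      (.instr (.add 10 10 1) ⟫ branch 16 11 (.instr (.move 11 16) ⟫ .instr (.move 12 3)) skip)
      (.instr (.write 3 3 1))

/-- Register `13` says whether there is a hub, and register `15` is one of minimum weight. -/
def findHub : Prog :=
  forVertices <| loadDegree ⟫ .instr (.add 16 16 1) ⟫
    branch 16 10 skip (branch 10 16 skip (
      .instr (.load 17 2 3) ⟫
        branch 13 1 (.instr (.move 14 17) ⟫ .instr (.move 15 3) ⟫ .instr (.const 13 1))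
          (branch 17 14 (.instr (.move 14 17) ⟫ .instr (.move 15 3) ⟫ .instr (.const 13 1)) skip)))

end Prog

/-! ### Correctness of the degree scan and of the hub search -/

section

variable {n w : ℕ} {G : SimpleGraph (Fin n)} {adj : Fin n → List (Fin n)} {ω : Fin n → ℕ}
  {s : Store}

theorem Runs.loadDegree (hs : Holds adj ω s) (hw : n + offset adj n ≤ w) {a : Fin n}
    (ha : s.reg 3 = a) : Runs w .loadDegree s 4 fun s' => s'.reg 16 = (adj a).length := by
  have h1 := hs.offset a.2.le
  have h2 : s.arr 0 (a.1 + 1) = offset adj (a + 1) := hs.offset a.2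
  have h3 := offset_succ adj a
  have h4 := offset_mono adj (show a.1 + 1 ≤ n from a.2)
  refine .step ?_ (.step ?_ (.step ?_ (.instr ?_ ?_))) <;>
    simp [ha, hs.one, h1, h2] <;> omega

/-- What `scanDegrees` has computed when it has seen the vertices below `k`. -/
structure ScanDegrees (G : SimpleGraph (Fin n)) (adj : Fin n → List (Fin n)) (k : ℕ) (s : Store) :
    Prop where
  size : s.reg 10 = countBelow (fun a => a ∉ isolated G) k
  min_le : ∀ a : Fin n, a.1 < k → a ∉ isolated G → s.reg 11 ≤ (adj a).length
  min_eq : s.reg 11 = n ∨ ∃ v : Fin n, s.reg 12 = v ∧ s.reg 11 = (adj v).length ∧ v ∉ isolated G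
  mark : ∀ a : Fin n, s.arr 3 a = 1 ↔ a.1 < k ∧ a ∈ isolated G
  mark_le : ∀ a : Fin n, s.arr 3 a ≤ 1

theorem Runs.scanDegrees (hG : IsAdjLists G adj) (hs : Holds adj ω s)
    (hw : n + offset adj n + 1 ≤ w) (h10 : s.reg 10 = 0) (h11 : s.reg 11 = n)
    (h3 : ∀ a : Fin n, s.arr 3 a = 0) :
    Runs w .scanDegrees s (11 * n + 2) (ScanDegrees G adj n) := by
  refine (Runs.forVertices hs (by omega) (by decide) (by decide) (ScanDegrees G adj)
    (fun k s y h => ⟨h.1, h.2, h.3, h.4, h.5⟩) (fun _ => 9) ⟨?_, ?_, ?_, ?_, ?_⟩ ?_).mono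
    (by simp; omega) fun _ _ h => h
  · rw [countBelow_zero, h10]
  · simp
  · exact Or.inl h11
  · simp [h3]
  · simp [h3]
  · intro a s₁ _ hs₁ ha₁ hI
    refine (Runs.loadDegree hs₁ (by omega) ha₁).seq (T' := 5) fun s₂ hs₂ hd => ?_
    have ha₂ : s₂.reg 3 = a := by rw [hs₂.reg 3 (by decide), ha₁]
    have h10 := hs₂.reg 10 (by decide)
    have h11 := hs₂.reg 11 (by decide)
    have h12 := hs₂.reg 12 (by decide)
    have h3 := hs₂.arr 3 (by decide)
    replace hs₂ := hs₁.agree hs₂ (by decide)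
    have hI₂ : ScanDegrees G adj a s₂ := by
      refine ⟨?_, ?_, ?_, ?_, ?_⟩
      · rw [h10]; exact hI.1
      · rw [h11]; exact hI.2
      · rw [h11, h12]; exact hI.3
      · rw [h3]; exact hI.4
      · rw [h3]; exact hI.5
    clear hI h10 h11 h12 h3
    have hcount := countBelow_le (fun a => a ∉ isolated G) a
    have hai := hG.mem_isolated_iff a
    have hlt := hG.length_lt a
    have ha := a.2
    refine .branch (fun hlt' => ?_) fun hlt' => ?_
    · rw [hs₂.zero, hd] at hlt'
      have hai' : a ∉ isolated G := by rw [hai]; omega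
      refine .step (T := 3) (by simp [hI₂.1, hs₂.one]; omega) ?_
      refine .branch (fun h => ?_) fun h => ?_
      · refine .step (T := 1) (by simp [hd]; omega) (.instr (by simp [ha₂]; omega) ?_)
        simp [hd] at h
        refine ⟨?_, ?_, ?_, ?_, ?_⟩
        · simp [hI₂.1, countBelow_succ, hai', hs₂.one]
        · intro b hb hbi
          rcases Nat.lt_succ_iff_lt_or_eq.1 hb with hb | hb
          · have := hI₂.2 b hb hbi
            simp [hd]; omega
          · rw [Fin.val_inj] at hb
            simp [hd, hb]
        · exact Or.inr ⟨a, by simp [ha₂], by simp [hd], hai'⟩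
        · intro b
          simp only [arr_move, arr_add, hI₂.4]
          have : b ∈ isolated G → b ≠ a := fun h h' => hai' (h' ▸ h)
          constructor
          · rintro ⟨h1, h2⟩; exact ⟨by omega, h2⟩
          · rintro ⟨h1, h2⟩; have := this h2; exact ⟨by omega, h2⟩
        · simpa using hI₂.5
      · refine (Runs.skip ?_).mono (show 1 ≤ 2 by omega) fun _ _ h => h
        simp [hd] at h
        refine ⟨?_, ?_, ?_, ?_, ?_⟩
        · simp [hI₂.1, countBelow_succ, hai', hs₂.one]
        · intro b hb hbi
          rcases Nat.lt_succ_iff_lt_or_eq.1 hb with hb | hb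
          · simpa using hI₂.2 b hb hbi
          · rw [Fin.val_inj] at hb
            simpa [hb] using h
        · simpa using hI₂.3
        · intro b
          simp only [arr_add, hI₂.4]
          have : b ∈ isolated G → b ≠ a := fun h h' => hai' (h' ▸ h)
          constructor
          · rintro ⟨h1, h2⟩; exact ⟨by omega, h2⟩
          · rintro ⟨h1, h2⟩; have := this h2; exact ⟨by omega, h2⟩
        · simpa using hI₂.5
    · rw [hs₂.zero, hd] at hlt'
      have hai' : a ∈ isolated G := by rw [hai]; omega
      refine (Runs.instr (by simp [hs₂.one]; omega) ?_).mono (show 1 ≤ 4 by omega) fun _ _ h => h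
      refine ⟨?_, ?_, ?_, ?_, ?_⟩
      · simp [hI₂.1, countBelow_succ, hai']
      · intro b hb hbi
        have : b ≠ a := fun h => hbi (h ▸ hai')
        exact hI₂.2 b (by omega) hbi
      · simpa using hI₂.3
      · intro b
        simp only [arr_write, true_and, ha₂, hs₂.one, Fin.val_inj]
        split_ifs with h
        · subst h; simp [hai']
        · rw [hI₂.4]
          constructor
          · rintro ⟨h1, h2⟩; exact ⟨by omega, h2⟩
          · rintro ⟨h1, h2⟩; exact ⟨by omega, h2⟩
      · intro b
        simp only [arr_write, true_and, ha₂, hs₂.one]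
        split_ifs
        · rfl
        · exact hI₂.5 b

/-- What `findHub` has computed when it has seen the vertices below `k`. -/
def FindHub (G : SimpleGraph (Fin n)) (ω : Fin n → ℕ) (k : ℕ) (s : Store) : Prop :=
  (s.reg 13 = 0 ∧ ∀ a : Fin n, a.1 < k → ¬ IsHub G a) ∨
    (s.reg 13 = 1 ∧ ∃ z : Fin n, s.reg 15 = z ∧ IsHub G z ∧ s.reg 14 = ω z ∧
      ∀ a : Fin n, a.1 < k → IsHub G a → ω z ≤ ω a)

theorem Runs.findHub (hG : IsAdjLists G adj) (hs : Holds adj ω s)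
    (hw : n + offset adj n + Finset.univ.sup ω + 1 ≤ w) (h10 : s.reg 10 = coreSize G)
    (h13 : s.reg 13 = 0) : Runs w .findHub s (15 * n + 2) (FindHub G ω n) := by
  refine (Runs.forVertices hs (by omega) (by decide) (by decide) (FindHub G ω)
    (fun k s y h => h) (fun _ => 13) ?_ ?_).mono
    (by simp; omega) fun _ _ h => h
  · exact Or.inl ⟨h13, by simp⟩
  · intro a s₁ hsa hs₁ ha₁ hI
    refine (Runs.loadDegree hs₁ (by omega) ha₁).seq (T' := 9) fun s₂ hs₂ hd => ?_
    have ha₂ : s₂.reg 3 = a := by rw [hs₂.reg 3 (by decide), ha₁]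
    have h10₂ : s₂.reg 10 = coreSize G := by
      rw [hs₂.reg 10 (by decide), hsa.reg 10 (by decide), h10]
    have hI₂ : FindHub G ω a s₂ := by
      unfold FindHub
      rw [hs₂.reg 13 (by decide), hs₂.reg 14 (by decide), hs₂.reg 15 (by decide)]
      exact hI
    replace hs₂ := hs₁.agree hs₂ (by decide)
    clear hI hsa
    have hlt := hG.length_lt a
    have ha := a.2
    have hwt : ω a ≤ Finset.univ.sup ω := Finset.le_sup (Finset.mem_univ a)
    have hhub := hG.isHub_iff a
    have hskip : ¬ IsHub G a → FindHub G ω (a + 1) s₂ := by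
      intro hna
      have : ∀ b : Fin n, b.1 < a + 1 → IsHub G b → b.1 < a := by
        intro b hb hbh
        have : b ≠ a := by rintro rfl; exact hna hbh
        omega
      rcases hI₂ with ⟨h1, h2⟩ | ⟨h1, z, h2, h3, h4, h5⟩
      · exact Or.inl ⟨h1, fun b hb hbh => h2 b (this b hb hbh) hbh⟩
      · exact Or.inr ⟨h1, z, h2, h3, h4, fun b hb hbh => h5 b (this b hb hbh) hbh⟩
    refine .step (T := 8) (by simp [hd, hs₂.one]; omega) ?_
    -- The machine only tests `<`; equality of degree plus one and `coreSize G` is the failure of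
    -- both strict comparisons.
    refine .branch (fun h => ?_) fun h => .branch (fun h' => ?_) fun h' => ?_
    · simp [hd, hs₂.one, h10₂] at h
      exact (Runs.skip (by simpa [FindHub] using hskip (by rw [hhub]; omega))).mono
        (show 1 ≤ 7 by omega) fun _ _ h => h
    · simp [hd, hs₂.one, h10₂] at h'
      exact (Runs.skip (by simpa [FindHub] using hskip (by rw [hhub]; omega))).mono
        (show 1 ≤ 6 by omega) fun _ _ h => h
    · simp [hd, hs₂.one, h10₂] at h h'
      have hah : IsHub G a := by rw [hhub]; omega
      refine .step (T := 5) (by simp [ha₂, hs₂.weight a]; omega) ?_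
      have hupd : (∀ b : Fin n, b.1 < a → IsHub G b → ω a ≤ ω b) →
          Runs w (.instr (.move 14 17) ⟫ .instr (.move 15 3) ⟫ .instr (.const 13 1))
            ((Instr.load 17 2 3).apply ((Instr.add 16 16 1).apply s₂)) 3
            (FindHub G ω (a + 1)) := by
        intro hmin
        refine .step (T := 2) (by simp [ha₂, hs₂.weight a]; omega) <|
          .step (T := 1) (by simp [ha₂]; omega) <| .instr (by simp; omega) ?_
        refine Or.inr ⟨by simp, a, by simp [ha₂], hah, by simp [ha₂, hs₂.weight a], ?_⟩
        intro b hb hbh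
        by_cases hba : b = a
        · rw [hba]
        · exact hmin b (by omega) hbh
      refine .branch (fun h13 => (hupd fun b hb hbh => ?_).mono (show 3 ≤ 4 by omega)
        fun _ _ h => h) fun h13 => .branch (fun h14 => hupd fun b hb hbh => ?_) fun h14 => ?_
      · simp [hs₂.one] at h13
        rcases hI₂ with ⟨h1, h2⟩ | ⟨h1, -⟩
        · exact absurd hbh (h2 b hb)
        · omega
      · simp [hs₂.one] at h13
        simp [ha₂, hs₂.weight a] at h14
        rcases hI₂ with ⟨h1, h2⟩ | ⟨h1, z, h2, h3, h4, h5⟩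
        · omega
        · have := h5 b hb hbh
          omega
      · simp [hs₂.one] at h13
        simp [ha₂, hs₂.weight a] at h14
        refine (Runs.skip ?_).mono (show 1 ≤ 3 by omega) fun _ _ h => h
        rcases hI₂ with ⟨h1, h2⟩ | ⟨h1, z, h2, h3, h4, h5⟩
        · omega
        · refine Or.inr ⟨by simpa using h1, z, by simpa using h2, h3, by simpa using h4, ?_⟩
          intro b hb hbh
          by_cases hba : b = a
          · rw [hba]; omega
          · exact h5 b (by omega) hbh

end

end EffDom

namespace EffDom

/-! ### Excluding the neighbours of a vertex of minimum degree -/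

namespace Prog

/-- Sets the entries of array `4` at the neighbours of the vertex in register `src`. -/
def markNeighbors (src : ℕ) : Prog := forNeighbors src 4 (.instr (.write 4 6 1))

/-- Lists in array `5` the vertices that are not marked in array `4` and have an unmarked
neighbour; register `18` is their number. -/
def findCore : Prog :=
  forVertices <| .instr (.load 16 4 3) ⟫
    branch 16 1
      (.instr (.move 19 2) ⟫
        forNeighbors 3 4 (.instr (.load 17 4 6) ⟫ branch 17 1 (.instr (.move 19 1)) skip) ⟫
        branch 2 19 (.instr (.write 5 18 3) ⟫ .instr (.add 18 18 1)) skip)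
      skip

/-- Writes the stamp in register `20` to the entries of array `6` at the neighbours of the vertex
in register `6`. -/
def stampNeighbors : Prog := forNeighbors 6 7 (.instr (.write 6 9 20))

/-- Register `21` becomes a vertex of the list in array `5` without the current stamp, if there is
one, and the content of register `6` otherwise. -/
def pickUnstamped : Prog :=
  .instr (.move 21 6) ⟫ .instr (.move 22 2) ⟫
    loop 22 18 (.instr (.load 17 5 22) ⟫ .instr (.load 16 6 17) ⟫
      branch 16 20 (.instr (.move 21 17)) skip ⟫ .instr (.add 22 22 1))

/-- Register `23` becomes `1` if the vertex in register `21` has an unmarked neighbour without the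
current stamp. -/
def testPicked : Prog :=
  forNeighbors 21 7 (.instr (.load 17 4 9) ⟫ .instr (.load 16 6 9) ⟫
    branch 17 1 (branch 16 20 (.instr (.const 23 1)) skip) skip)

/-- Excludes the neighbours of the vertex in register `12` from the efficient dominating sets, or
finds an induced `2P₂` and sets register `23`. -/
def excludeNeighbors : Prog :=
  forNeighbors 12 4 (.instr (.add 20 20 1) ⟫ stampNeighbors ⟫ pickUnstamped ⟫ testPicked)

end Prog

section

variable {n w : ℕ} {G : SimpleGraph (Fin n)} {adj : Fin n → List (Fin n)} {ω : Fin n → ℕ}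
  {s : Store}

theorem Runs.markNeighbors (hs : Holds adj ω s) (hw : n + offset adj n + 1 ≤ w) {a : Fin n}
    {src : ℕ} (ha : s.reg src = a) (hsrc : src ≠ 4) :
    Runs w (.markNeighbors src) s ((adj a).length * 4 + 4) fun s' =>
      ∀ b : Fin n, (b ∈ adj a → s'.arr 4 b = 1) ∧ (b ∉ adj a → s'.arr 4 b = s.arr 4 b) := by
  refine Runs.forNeighbors hs (by omega) ha (by omega) hsrc (by decide) (by decide) (by decide)
    (fun l s' => ∀ b : Fin n, (b ∈ l → s'.arr 4 b = 1) ∧ (b ∉ l → s'.arr 4 b = s.arr 4 b))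
    (fun _ _ _ h => h) (fun _ _ _ h => h) (fun _ _ _ h => h) 1 (by simp) ?_
  intro l b r _ s' _ hs' hb hI
  refine .instr (by simp [hs'.one]; omega) fun c => ?_
  have := hI c
  by_cases hcb : c = b
  · simp [hb, hcb, hs'.one]
  · simpa [hb, hcb, Fin.val_inj] using this

/-- What `findCore` has computed when it has seen the vertices below `k`. -/
structure FindCore (G : SimpleGraph (Fin n)) (v : Fin n) (k : ℕ) (s : Store) : Prop where
  size : s.reg 18 = countBelow (fun a => a ∈ farCore G v) k
  mem : ∀ i < s.reg 18, ∃ a : Fin n, s.arr 5 i = a ∧ a ∈ farCore G v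
  exists_eq : ∀ a : Fin n, a.1 < k → a ∈ farCore G v → ∃ i < s.reg 18, s.arr 5 i = a

theorem Runs.findCore (hG : IsAdjLists G adj) (hs : Holds adj ω s)
    (hw : n + offset adj n + 1 ≤ w) {v : Fin n}
    (h4 : ∀ a : Fin n, s.arr 4 a < 1 ↔ a ∈ far G v) (h4' : ∀ a : Fin n, s.arr 4 a ≤ 1)
    (h18 : s.reg 18 = 0) :
    Runs w .findCore s (6 * offset adj n + 12 * n + 2) (FindCore G v n) := by
  refine (Runs.forVertices hs (by omega) (by decide) (by decide) (FindCore G v)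
    (fun k s y h => ⟨h.1, h.2, h.3⟩) (fun a => 6 * (adj a).length + 10) ⟨?_, ?_, ?_⟩ ?_).mono
    ?_ fun _ _ h => h
  · rw [h18, countBelow_zero]
  · simp [h18]
  · simp
  · intro a s₁ hsa hs₁ ha₁ hI
    have h4₁ : s₁.arr 4 = s.arr 4 := hsa.arr 4 (by decide)
    have ha := a.2
    have h4a := h4' a
    have hcount := countBelow_le (fun a => a ∈ farCore G v) a
    have hskip : ∀ s', s'.reg 18 = s₁.reg 18 → s'.arr 5 = s₁.arr 5 → a ∉ farCore G v →
        FindCore G v (a + 1) s' := by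
      intro s' hs18 hs5 hac
      refine ⟨?_, ?_, ?_⟩
      · simp [hs18, hI.1, countBelow_succ, hac]
      · rw [hs18, hs5]; exact hI.2
      · intro b hb hbc
        have : b ≠ a := by rintro rfl; exact hac hbc
        rw [hs18, hs5]
        exact hI.3 b (by omega) hbc
    refine .step (T := 6 * (adj a).length + 9) (by simp [ha₁, h4₁]; omega) ?_
    refine .branch (fun h => ?_) fun h => ?_
    · simp [ha₁, hs₁.one, h4₁] at h
      have hfar : a ∈ far G v := (h4 a).1 (by omega)
      refine .step (T := 6 * (adj a).length + 7) (by simp [hs₁.zero]) ?_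
      set s₂ := (Instr.move 19 2).apply ((Instr.load 16 4 3).apply s₁) with hs₂
      have hagree : Agree .findCore s₁ s₂ :=
        (Agree.apply _ (by decide) (by decide)).trans (Agree.apply _ (by decide) (by decide))
      have hs₂' := hs₁.agree hagree (by decide)
      refine ((Runs.forNeighbors (w := w) (src := 3) (j := 4) (s := s₂) (a := a)
        hs₂' (by omega) (by simp [hs₂, ha₁]) (by decide) (by decide) (by decide)
        (by decide) (by decide)
        (fun l s => s.reg 19 ≤ 1 ∧ (0 < s.reg 19 ↔ ∃ b ∈ l, b ∈ far G v)) (fun _ _ _ h => h)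
        (fun _ _ _ h => h) (fun _ _ _ h => h) 3 (by simp [hs₂, hs₁.zero]) ?_).seq (T' := 3)
        fun s₃ hs₃ hI₃ => ?_).mono (by omega) fun _ _ h => h
      · intro l b r _ s₃ hs₃ hs₃' hb hI₃
        have h4₃ : s₃.arr 4 = s.arr 4 := by
          rw [hs₃.arr 4 (by decide), hagree.arr 4 (by decide), h4₁]
        have h4b := h4' b
        refine .step (T := 2) (by simp [hb, h4₃]; omega) ?_
        refine .branch (fun h => .instr (by simp [hs₃'.one]; omega) ?_) fun h => .skip ?_
        · simp [hb, h4₃, hs₃'.one] at h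
          have hbf : b ∈ far G v := (h4 b).1 (by omega)
          simp [hs₃'.one, hbf, or_and_right, exists_or]
        · simp [hb, h4₃, hs₃'.one] at h
          have hbf : b ∉ far G v := fun h' => by have := (h4 b).2 h'; omega
          simpa [hbf, or_and_right, exists_or] using hI₃
      · have ha₃ : s₃.reg 3 = a := by rw [hs₃.reg 3 (by decide)]; simp [hs₂, ha₁]
        have h18 : s₃.reg 18 = s₁.reg 18 := by
          rw [hs₃.reg 18 (by decide)]; simp [hs₂]
        have h5 : s₃.arr 5 = s₁.arr 5 := by
          rw [hs₃.arr 5 (by decide)]; simp [hs₂]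
        have hs₃' := hs₂'.agree hs₃ (by decide)
        have hcore : 0 < s₃.reg 19 ↔ a ∈ farCore G v := by
          rw [hI₃.2]
          constructor
          · rintro ⟨b, hb, hb'⟩
            exact ⟨hfar, b, hb', ((hG a).2 b).1 hb⟩
          · rintro ⟨_, b, hb', hb⟩
            exact ⟨b, ((hG a).2 b).2 hb, hb'⟩
        refine .branch (fun h => ?_) fun h => ?_
        · rw [hs₃'.zero, hcore] at h
          refine .step (T := 1) (by simp [ha₃]; omega) <| .instr ?_ ?_
          · simp [h18, hI.1, hs₃'.one]; omega
          · refine ⟨?_, ?_, ?_⟩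
            · simp [h18, hI.1, hs₃'.one, countBelow_succ, h]
            · intro i hi
              simp [h18, hs₃'.one] at hi
              by_cases hi' : i = s₁.reg 18
              · exact ⟨a, by simp [h18, hi', ha₃], h⟩
              · obtain ⟨b, hb, hbc⟩ := hI.2 i (by omega)
                exact ⟨b, by simp [h18, hi', h5, hb], hbc⟩
            · intro b hb hbc
              by_cases hba : b = a
              · exact ⟨s₁.reg 18, by simp [h18, hs₃'.one], by simp [h18, ha₃, hba]⟩
              · obtain ⟨i, hi, hib⟩ := hI.3 b (by omega) hbc
                exact ⟨i, by simp [h18, hs₃'.one]; omega, by simp [h18, h5, hi.ne, hib]⟩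
        · rw [hs₃'.zero, hcore] at h
          exact (Runs.skip (hskip _ h18 h5 h)).mono (show 1 ≤ 2 by omega) fun _ _ h => h
    · simp [ha₁, hs₁.one, h4₁] at h
      refine (Runs.skip (hskip _ (by simp) (by simp) ?_)).mono (by omega) fun _ _ h => h
      intro hac
      have := (h4 a).2 hac.1
      omega
  · simp only [Finset.sum_add_distrib, ← Finset.mul_sum, ← offset_eq_sum]
    simp
    omega

theorem Runs.stampNeighbors (hs : Holds adj ω s) (hw : n + offset adj n ≤ w) {u : Fin n} {k : ℕ}
    (hu : s.reg 6 = u) (h20 : s.reg 20 = k) (hk : k ≤ w) (h6 : ∀ b : Fin n, s.arr 6 b < k) :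
    Runs w .stampNeighbors s ((adj u).length * 4 + 4) fun s' =>
      ∀ b : Fin n, s'.arr 6 b ≤ k ∧ (s'.arr 6 b < k ↔ b ∉ adj u) := by
  refine Runs.forNeighbors hs (by omega) hu (by omega) (by decide) (by decide) (by decide)
    (by decide) (fun l s' => ∀ b : Fin n, s'.arr 6 b ≤ k ∧ (s'.arr 6 b < k ↔ b ∉ l))
    (fun _ _ _ h => h) (fun _ _ _ h => h) (fun _ _ _ h => h) 1
    (fun b => ⟨(h6 b).le, by simp [h6]⟩) ?_
  intro l b r _ s' hsa hs' hb hI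
  have h20' : s'.reg 20 = k := by rw [hsa.reg 20 (by decide), h20]
  refine .instr (by simp [h20', hk]) fun c => ?_
  have := hI c
  by_cases hcb : c = b
  · simp [hb, hcb, h20']
  · simpa [hb, hcb, Fin.val_inj] using this

/-- The default u is harmless: all its neighbours carry the stamp, so the test that follows cannot
fail for it. -/
theorem Runs.pickUnstamped (hs : Holds adj ω s) {v u : Fin n} {k : ℕ} (hw : n ≤ w)
    (hu : s.reg 6 = u) (h20 : s.reg 20 = k) (hk : k ≤ w)
    (h6 : ∀ b : Fin n, s.arr 6 b ≤ k ∧ (s.arr 6 b < k ↔ ¬ G.Adj u b)) (h18 : s.reg 18 ≤ w)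
    (hcore : FindCore G v n s) :
    Runs w .pickUnstamped s (6 * s.reg 18 + 3) fun s' => ∃ x : Fin n, s'.reg 21 = x ∧
      ((x = u ∧ ∀ y ∈ farCore G v, G.Adj u y) ∨ (x ∈ farCore G v ∧ ¬ G.Adj u x)) := by
  have hu' := u.2
  refine .step (T := 6 * s.reg 18 + 2) (by simp [hu]; omega) <|
    .step (T := 6 * s.reg 18 + 1) (by simp [hs.zero]) ?_
  refine (Runs.loop (w := w) (fun i s' => ∃ x : Fin n, s'.reg 21 = x ∧
      ((x = u ∧ ∀ j < i, ∀ y : Fin n, s.arr 5 j = y → G.Adj u y) ∨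
        (x ∈ farCore G v ∧ ¬ G.Adj u x))) (fun _ => 5) 0 (s.reg 18) (by omega) ?_ ?_ ?_ (by decide)
      ?_).mono ?_ ?_
  · exact ⟨u, by simp [hu], by simp⟩
  · simp [hs.zero]
  · simp
  · intro i _ hi s' hs' hi' hI
    have h5' : s'.arr 5 = s.arr 5 := by rw [hs'.arr 5 (by decide)]; simp
    have h6' : s'.arr 6 = s.arr 6 := by rw [hs'.arr 6 (by decide)]; simp
    have h20' : s'.reg 20 = k := by rw [hs'.reg 20 (by decide), ← h20]; simp
    have h1' : s'.reg 1 = 1 := by rw [hs'.reg 1 (by decide)]; simp [hs.one]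
    obtain ⟨y, hy, hyc⟩ := hcore.2 i hi
    have hy' := y.2
    have h6y := h6 y
    refine .step (T := 4) (by simp [hi', h5', hy]; omega) <|
      .step (T := 3) (by simp [hi', h5', hy, h6']; omega) ?_
    refine (Runs.branch (T := 1) (Q := fun s'' => s''.reg 22 = i ∧ s''.reg 1 = 1 ∧
      ∃ x : Fin n, s''.reg 21 = x ∧
        ((x = u ∧ ∀ j < i + 1, ∀ y : Fin n, s.arr 5 j = y → G.Adj u y) ∨
          (x ∈ farCore G v ∧ ¬ G.Adj u x)))
      (fun h => .instr ?_ ?_) fun h => .skip ?_).seq fun s'' _ h => .instr ?_ ?_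
    · simp [hi', h5', hy]; omega
    · simp [hi', h5', hy, h6', h20', h6y.2] at h
      exact ⟨by simp [hi'], by simp [h1'], y, by simp [hi', h5', hy], Or.inr ⟨hyc, h⟩⟩
    · simp only [reg_load, hi', h5', hy, h20'] at h
      simp only [Nat.reduceEqDiff, ↓reduceIte, arr_load, h6', h6y.2, not_not] at h
      obtain ⟨x, hx, hx'⟩ := hI
      refine ⟨by simp [hi'], by simp [h1'], x, by simp [hx], hx'.imp_left fun hx' => ⟨hx'.1, ?_⟩⟩
      intro j hj z hz
      rcases Nat.lt_succ_iff_lt_or_eq.1 hj with hj | rfl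
      · exact hx'.2 j hj z hz
      · rw [hy, Fin.val_inj] at hz
        exact hz ▸ h
    · simp [h.1, h.2.1]; omega
    · simpa [h.1, h.2.1] using h.2.2
  · simp; omega
  · rintro s' _ ⟨x, hx, h⟩
    refine ⟨x, hx, h.imp_left fun h => ⟨h.1, fun y hy => ?_⟩⟩
    obtain ⟨i, hi, hiy⟩ := hcore.3 y y.2 hy
    exact h.2 i hi y hiy

/-- An unmarked, unstamped neighbour b of x is far from v and not adjacent to u; this rules out x =
u, and then vu and xb induce a `2P₂`. If there is no such b, then x is the vertex needed to exclude
u. -/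
theorem Runs.testPicked (hs : Holds adj ω s) (hG : IsAdjLists G adj) {v u x : Fin n} {k : ℕ}
    (hw : n + offset adj n + 1 ≤ w) (hx : s.reg 21 = x) (h20 : s.reg 20 = k) (hk : k ≤ w)
    (hvu : G.Adj v u) (h6 : ∀ b : Fin n, s.arr 6 b ≤ k ∧ (s.arr 6 b < k ↔ ¬ G.Adj u b))
    (h4 : ∀ a : Fin n, s.arr 4 a < 1 ↔ a ∈ far G v) (h4' : ∀ a : Fin n, s.arr 4 a ≤ 1)
    (hxu : x = u ∨ x ∈ farCore G v ∧ ¬ G.Adj u x)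
    (h23 : s.reg 23 = 0 ∨ s.reg 23 = 1 ∧ ¬ TwoPTwoFree G) :
    Runs w .testPicked s ((adj x).length * 8 + 4) fun s' =>
      (s'.reg 23 = 0 ∧ s.reg 23 = 0 ∧ ∀ b ∈ far G v, G.Adj x b → G.Adj u b) ∨
        (s'.reg 23 = 1 ∧ ¬ TwoPTwoFree G) := by
  refine (Runs.forNeighbors (j := 7) hs (by omega) hx (by omega) (by decide) (by decide) (by decide)
    (by decide) (fun l s' => (s'.reg 23 = 0 ∧ s.reg 23 = 0 ∧
      ∀ b ∈ l, b ∈ far G v → G.Adj u b) ∨ (s'.reg 23 = 1 ∧ ¬ TwoPTwoFree G))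
    (fun _ _ _ h => h) (fun _ _ _ h => h) (fun _ _ _ h => h) 5 ?_ ?_).mono le_rfl ?_
  · simpa using h23
  · intro l b r hl s' hsa hs' hb hI
    have hxb : G.Adj x b := by rw [← (hG x).2, hl]; simp
    have h20' : s'.reg 20 = k := by rw [hsa.reg 20 (by decide), h20]
    have h4s : s'.arr 4 = s.arr 4 := hsa.arr 4 (by decide)
    have h6s : s'.arr 6 = s.arr 6 := hsa.arr 6 (by decide)
    have h4b := h4' b
    have h6b := h6 b
    refine .step (T := 4) (by simp [hb, h4s]; omega) <|
      .step (T := 3) (by simp [hb, h6s]; omega) ?_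
    have hskip : (b ∈ far G v → G.Adj u b) → (s'.reg 23 = 0 ∧ s.reg 23 = 0 ∧
        ∀ c ∈ l ++ [b], c ∈ far G v → G.Adj u c) ∨ (s'.reg 23 = 1 ∧ ¬ TwoPTwoFree G) := by
      intro h
      refine hI.imp_left fun hI => ⟨hI.1, hI.2.1, fun c hc => ?_⟩
      rcases List.mem_append.1 hc with hc | hc
      · exact hI.2.2 c hc
      · rw [List.mem_singleton.1 hc]
        exact h
    refine .branch (fun h => .branch (fun h' => .instr ?_ ?_) fun h' => .skip ?_) fun h => ?_
    · simp; omega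
    · simp [hb, h4s, h6s, h20', hs'.one] at h h'
      have hbf : b ∈ far G v := (h4 b).1 (by omega)
      have hub : ¬ G.Adj u b := h6b.2.1 h'
      rcases hxu with rfl | ⟨hxc, hux⟩
      · exact absurd hxb hub
      · exact Or.inr ⟨by simp, fun hfree => hub (hfree.adj_of_mem_far hvu hxc.1 hbf hxb hux)⟩
    · have h'' : ¬ s.arr 6 b < k := by simpa [hb, h6s, h20'] using h'
      simpa using hskip fun _ => not_not.1 fun h => h'' (h6b.2.2 h)
    · have h'' : ¬ s.arr 4 b < 1 := by simpa [hb, h4s, hs'.one] using h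
      refine (Runs.skip ?_).mono (show 1 ≤ 2 by omega) fun _ _ h => h
      simpa using hskip fun hbf => absurd ((h4 b).2 hbf) h''
  · intro s' _ h
    exact h.imp_left fun h => ⟨h.1, h.2.1, fun b hb hxb => h.2.2 b (((hG x).2 b).2 hxb) hb⟩

/-- If some vertex of `farCore G v` is not adjacent to `u`, then there is one whose neighbours far
from `v` are all adjacent to `u`. -/
def Covers (G : SimpleGraph (Fin n)) (v u : Fin n) : Prop :=
  (∃ w ∈ farCore G v, ¬ G.Adj u w) →
    ∃ w ∈ farCore G v, ¬ G.Adj u w ∧ ∀ b ∈ far G v, G.Adj w b → G.Adj u b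

theorem Runs.excludeNeighbors (hs : Holds adj ω s) (hG : IsAdjLists G adj) {v : Fin n}
    (hw : n + offset adj n + 1 ≤ w) (hv : s.reg 12 = v)
    (hmin : ∀ a, a ∉ isolated G → (adj v).length ≤ (adj a).length)
    (h4 : ∀ a : Fin n, s.arr 4 a < 1 ↔ a ∈ far G v) (h4' : ∀ a : Fin n, s.arr 4 a ≤ 1)
    (h6 : ∀ a : Fin n, s.arr 6 a = 0) (h20 : s.reg 20 = 0) (h23 : s.reg 23 = 0)
    (hcore : FindCore G v n s) :
    Runs w .excludeNeighbors s (33 * offset adj n + 4) fun s' =>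
      (s'.reg 23 = 0 ∧ ∀ u, G.Adj v u → Covers G v u) ∨
        (s'.reg 23 = 1 ∧ ¬ TwoPTwoFree G) := by
  have hoff : (adj v).length ≤ offset adj n := by
    have h1 := offset_succ adj v
    have h2 := offset_mono adj (show v.1 + 1 ≤ n from v.2)
    omega
  refine (Runs.forNeighbors (j := 4) hs (by omega) hv (by omega) (by decide) (by decide) (by decide)
    (by decide) (fun l s' => s'.reg 20 = l.length ∧ (∀ b : Fin n, s'.arr 6 b ≤ l.length) ∧
      ((s'.reg 23 = 0 ∧ ∀ u ∈ l, Covers G v u) ∨ (s'.reg 23 = 1 ∧ ¬ TwoPTwoFree G)))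
    (fun _ _ _ h => h) (fun _ _ _ h => h) (fun _ _ _ h => h) (18 * coreSize G + 12) ?_
    ?_).mono ?_ ?_
  · simp [h6, h20, h23]
  · intro l u r hl s₁ hsa hs₁ hu₁ ⟨h20₁, h6₁, h23₁⟩
    have hvu : G.Adj v u := by rw [← (hG v).2, hl]; simp
    have hlen : l.length < (adj v).length := by rw [hl]; simp
    -- The stamp exceeds all earlier ones, so array 6 never has to be cleared.
    set k := l.length + 1 with hk
    set s₂ := (Instr.add 20 20 1).apply s₁ with hs₂
    have hagree : Agree .excludeNeighbors s₁ s₂ := Agree.apply _ (by decide) (by decide)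
    have hs₂' := hs₁.agree hagree (by decide)
    have h20₂ : s₂.reg 20 = k := by simp [hs₂, h20₁, hs₁.one, hk]
    have hdu := hG.length_le_coreSize u
    have hcs : s.reg 18 ≤ coreSize G := by
      rw [hcore.1]
      exact countBelow_mono fun a ha => notMem_isolated_of_adj ha.2.choose_spec.2
    have hcs' := coreSize_le (G := G)
    have h18₁ : s₁.reg 18 = s.reg 18 := hsa.reg 18 (by decide)
    have h4₁ : s₁.arr 4 = s.arr 4 := hsa.arr 4 (by decide)
    have h5₁ : s₁.arr 5 = s.arr 5 := hsa.arr 5 (by decide)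
    refine (Runs.step (T := 18 * coreSize G + 11) (by simp [h20₁, hs₁.one]; omega) ?_).mono le_rfl
      fun _ _ h => h
    refine ((Runs.stampNeighbors hs₂' (by omega) (u := u) (by simp [hs₂, hu₁]) h20₂ (by omega)
      ?_).seq (T' := 14 * coreSize G + 7) fun s₃ hs₃ h6₃ => ?_).mono (by omega) fun _ _ h => h
    · intro b
      have := h6₁ b
      simp [hs₂]
      omega
    have hs₃' := hs₂'.agree hs₃ (by decide)
    simp only [(hG u).2] at h6₃
    have h18₃ : s₃.reg 18 = s.reg 18 := by
      rw [hs₃.reg 18 (by decide), ← h18₁]; simp [hs₂]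
    have h20₃ : s₃.reg 20 = k := by rw [hs₃.reg 20 (by decide), h20₂]
    have hcore₃ : FindCore G v n s₃ := by
      have h5₃ : s₃.arr 5 = s.arr 5 := by
        rw [hs₃.arr 5 (by decide), ← h5₁]; simp [hs₂]
      exact ⟨by rw [h18₃, hcore.1], by rw [h18₃, h5₃]; exact hcore.2,
        by rw [h18₃, h5₃]; exact hcore.3⟩
    refine ((Runs.pickUnstamped (G := G) (v := v) (u := u) (k := k) hs₃' (by omega) ?_ h20₃
      (by omega) h6₃ (by omega) hcore₃).seq (T' := 8 * coreSize G + 4)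
      fun s₄ hs₄ ⟨x, hx, hxu⟩ => ?_).mono (by omega) fun _ _ h => h
    · rw [hs₃.reg 6 (by decide)]; simp [hs₂, hu₁]
    have hs₄' := hs₃'.agree hs₄ (by decide)
    have h6₄ : s₄.arr 6 = s₃.arr 6 := hs₄.arr 6 (by decide)
    have h20₄ : s₄.reg 20 = k := by rw [hs₄.reg 20 (by decide), h20₃]
    have h4₄ : s₄.arr 4 = s.arr 4 := by
      rw [hs₄.arr 4 (by decide), hs₃.arr 4 (by decide), ← h4₁]; simp [hs₂]
    have h23₄ : s₄.reg 23 = s₁.reg 23 := by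
      rw [hs₄.reg 23 (by decide), hs₃.reg 23 (by decide)]; simp [hs₂]
    have hdx := hG.length_le_coreSize x
    refine (Runs.testPicked (u := u) (v := v) (x := x) (k := k) hs₄' hG hw hx h20₄ (by omega) hvu
      (by rwa [h6₄]) (by rwa [h4₄]) (by rwa [h4₄]) (hxu.imp_left And.left) ?_).mono (by omega) ?_
    · rw [h23₄]; exact h23₁.imp_left And.left
    intro s₅ hs₅ h
    refine ⟨?_, ?_, h.imp_left ?_⟩
    · rw [hs₅.reg 20 (by decide), h20₄]; simp [hk]
    · rw [hs₅.arr 6 (by decide), h6₄]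
      simpa [hk] using fun b => (h6₃ b).1
    · rintro ⟨h1, h2, h3⟩
      refine ⟨h1, fun c hc => ?_⟩
      rw [h23₄] at h2
      rcases List.mem_append.1 hc with hc | hc
      · rcases h23₁ with h | h
        · exact h.2 c hc
        · omega
      · rw [List.mem_singleton.1 hc]
        rintro ⟨y, hy, huy⟩
        rcases hxu with ⟨-, hall⟩ | ⟨hxc, hux⟩
        · exact absurd (hall y hy) huy
        · exact ⟨x, hxc, hux, h3⟩
  -- The number of rounds is the minimum degree; its product with `coreSize G` is at most the length
  -- of the adjacency array, and 18 + 15 = 33.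
  · have := mul_coreSize_le hmin
    rw [show (adj v).length * (18 * coreSize G + 12 + 3) + 4 =
      18 * ((adj v).length * coreSize G) + 15 * (adj v).length + 4 by ring]
    omega
  · rintro s' _ ⟨-, -, h⟩
    exact h.imp_left fun h => ⟨h.1, fun u hu => h.2 u (((hG v).2 u).2 hu)⟩

end

end EffDom

namespace EffDom

/-! ### Building and checking the candidate, and the whole algorithm -/

namespace Prog

/-- Adds to the isolated vertices, marked in array `3`, the vertex `v` in register `12` and the
vertices that are dominated neither by `v` nor by its first neighbour. -/
def buildCandidate : Prog :=
  .instr (.load 25 0 12) ⟫ .instr (.load 25 1 25) ⟫ markNeighbors 25 ⟫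
    forVertices (.instr (.load 16 4 3) ⟫ branch 16 1 (.instr (.write 3 3 1)) skip) ⟫
    .instr (.write 3 12 1)

/-- Counts in array `7` for every vertex the vertices marked in array `3` that dominate it. -/
def countDominators : Prog :=
  forVertices <| .instr (.load 16 3 3) ⟫
    branch 2 16
      (.instr (.load 17 7 3) ⟫ .instr (.add 17 17 1) ⟫ .instr (.write 7 3 17) ⟫
        forNeighbors 3 4 (.instr (.load 17 7 6) ⟫ .instr (.add 17 17 1) ⟫ .instr (.write 7 6 17)))
      skip

/-- Register `23`, respectively `24`, becomes `1` if some vertex that is marked, respectively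
unmarked, in array `3` does not have exactly one dominator. -/
def checkCounts : Prog :=
  forVertices <| .instr (.load 17 3 3) ⟫ .instr (.load 16 7 3) ⟫
    branch 16 1 (branch 2 17 (.instr (.const 23 1)) (.instr (.const 24 1)))
      (branch 1 16 (branch 2 17 (.instr (.const 23 1)) (.instr (.const 24 1))) skip)

/-- The part of the algorithm for graphs without a hub. -/
def solveHubless : Prog :=
  .instr (.write 4 12 1) ⟫ markNeighbors 12 ⟫ findCore ⟫ excludeNeighbors ⟫ buildCandidate ⟫
    countDominators ⟫ checkCounts ⟫
    branch 2 23 (.instr (.const 0 2)) (branch 2 24 (.instr (.const 0 0)) (.instr (.const 0 1)))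

/-- The robust algorithm for weighted efficient domination on `2P₂`-free graphs. -/
def solve : Prog :=
  .instr (.const 1 1) ⟫ .instr (.move 11 0) ⟫ scanDegrees ⟫ findHub ⟫
    branch 10 1 (.instr (.const 0 1))
      (branch 2 13 (.instr (.write 3 15 1) ⟫ .instr (.const 0 1)) solveHubless)

end Prog

section

variable {n w : ℕ} {G : SimpleGraph (Fin n)} {adj : Fin n → List (Fin n)} {ω : Fin n → ℕ}
  {s : Store}

/-- After N(x) has been marked on top of N[v], the unmarked vertices are the set `S`. Isolated
vertices marked earlier in array 3 are in `S` anyway, except possibly v, which is added separately.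
-/
theorem Runs.buildCandidate (hG : IsAdjLists G adj) (hs : Holds adj ω s)
    (hw : n + offset adj n + 1 ≤ w) {v x : Fin n} {r : List (Fin n)} (hv : s.reg 12 = v)
    (hx : adj v = x :: r) (h4 : ∀ a : Fin n, s.arr 4 a < 1 ↔ a ∈ far G v)
    (h3 : ∀ a : Fin n, s.arr 3 a = 1 ↔ a ∈ isolated G) (h3' : ∀ a : Fin n, s.arr 3 a ≤ 1)
    (h4' : ∀ a : Fin n, s.arr 4 a ≤ 1) :
    Runs w .buildCandidate s (4 * offset adj n + 5 * n + 9) fun s' =>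
      ∀ a : Fin n, s'.arr 3 a ≤ 1 ∧ (s'.arr 3 a = 1 ↔ a = v ∨ (a ∈ far G v ∧ ¬ G.Adj x a)) := by
  have hoffv := hs.offset v.2.le
  have hfirst : s.arr 1 (offset adj v) = x := by
    simpa using hs.neighbor v x (l := []) (r := r) hx
  have hle := offset_mono adj v.2.le
  have hxlen : (adj x).length ≤ offset adj n := by
    have h1 := offset_succ adj x
    have h2 := offset_mono adj (show x.1 + 1 ≤ n from x.2)
    omega
  have hxn := x.2
  have hvn := v.2
  refine .step (T := 4 * offset adj n + 5 * n + 8) (by simp [hv, hoffv]; omega) <|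
    .step (T := 4 * offset adj n + 5 * n + 7) (by simp [hv, hoffv, hfirst]; omega) ?_
  set s₁ := (Instr.load 25 1 25).apply ((Instr.load 25 0 12).apply s) with hs₁
  have hs₁' : Holds adj ω s₁ := hs.agree (P := .buildCandidate)
    ((Agree.apply _ (by decide) (by decide)).trans (Agree.apply _ (by decide) (by decide)))
    (by decide)
  refine ((Runs.markNeighbors (a := x) hs₁' (by omega) (by simp [hs₁, hv, hoffv, hfirst])
    (by decide)).seq (T' := 5 * n + 3) fun s₂ hs₂ h4₂ => ?_).mono (by omega) fun _ _ h => h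
  have hs₂' := hs₁'.agree hs₂ (by decide)
  have h3₂ : s₂.arr 3 = s.arr 3 := by rw [hs₂.arr 3 (by decide)]; simp [hs₁]
  have hv₂ : s₂.reg 12 = v := by rw [hs₂.reg 12 (by decide)]; simp [hs₁, hv]
  have h4₁ : s₁.arr 4 = s.arr 4 := by simp [hs₁]
  have hmark : ∀ a : Fin n, s₂.arr 4 a ≤ 1 ∧ (s₂.arr 4 a < 1 ↔ a ∈ far G v ∧ ¬ G.Adj x a) := by
    intro a
    have h1 := h4 a
    have h2 := h4' a
    have h3 := h4₂ a
    rw [h4₁, (hG x).2] at h3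
    by_cases hxa : G.Adj x a
    · simp [h3.1 hxa, hxa]
    · rw [h3.2 hxa, h1]
      exact ⟨h2, by simp [hxa]⟩
  refine ((Runs.forVertices hs₂' (by omega) (by decide) (by decide) (fun k s' => ∀ a : Fin n,
    s'.arr 3 a ≤ 1 ∧ (s'.arr 3 a = 1 ↔
      a ∈ isolated G ∨ (a.1 < k ∧ a ∈ far G v ∧ ¬ G.Adj x a)))
    (fun k s y h => h) (fun _ => 3) ?_ ?_).seq (T' := 1) fun s₃ hs₃ h3₃ => .instr ?_ ?_).mono
    (by simp; omega) fun _ _ h => h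
  · intro a
    rw [h3₂, h3]
    exact ⟨h3' a, by simp⟩
  · intro a s' hsa hs' ha hI
    have h4s : s'.arr 4 = s₂.arr 4 := hsa.arr 4 (by decide)
    have hma := hmark a
    refine .step (T := 2) (by simp [ha, h4s]; omega) ?_
    refine .branch (fun h => .instr (by simp [hs'.one]; omega) fun b => ?_) fun h => .skip ?_
    · have h' : s₂.arr 4 a < 1 := by simpa [ha, h4s, hs'.one] using h
      have hb := hI b
      by_cases hba : b = a
      · simp [ha, hs'.one, hba, hma.2.1 h']
      · have : b.1 < a + 1 ↔ b.1 < a := by omega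
        simpa [ha, hs'.one, hba, Fin.val_inj, this] using hb
    · have h' : ¬ s₂.arr 4 a < 1 := by simpa [ha, h4s, hs'.one] using h
      rw [hma.2] at h'
      intro b
      have hb := hI b
      by_cases hba : b = a
      · simpa [hba, h'] using hI a
      · have : b.1 < a + 1 ↔ b.1 < a := by omega
        simpa [this] using hb
  · have hs₃' := hs₂'.agree hs₃ (by decide)
    simp [hs₃'.one]; omega
  · have hs₃' := hs₂'.agree hs₃ (by decide)
    have hv₃ : s₃.reg 12 = v := by rw [hs₃.reg 12 (by decide), hv₂]
    have hvx : G.Adj v x := by rw [← (hG v).2, hx]; simp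
    intro a
    by_cases hav : a = v
    · simp [hav, hv₃, hs₃'.one]
    · have ha := h3₃ a
      have hiso : a ∈ isolated G → a ∈ far G v ∧ ¬ G.Adj x a := fun hai =>
        ⟨fun h => hav (eq_of_dominates_of_mem_isolated hai h).symm, fun h => hai x h.symm⟩
      simp only [arr_write, hv₃, hs₃'.one, true_and, Fin.val_inj, hav, if_false, false_or]
      refine ⟨ha.1, ha.2.trans ⟨fun h => h.elim hiso And.right, fun h => Or.inr ⟨a.2, h⟩⟩⟩

theorem Runs.countDominators (hG : IsAdjLists G adj) (hs : Holds adj ω s)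
    (hw : n + offset adj n + 1 ≤ w) {D : Set (Fin n)}
    (h3 : ∀ a : Fin n, s.arr 3 a ≤ 1 ∧ (s.arr 3 a = 1 ↔ a ∈ D)) (h7 : ∀ a : Fin n, s.arr 7 a = 0) :
    Runs w .countDominators s (6 * offset adj n + 11 * n + 2) fun s' =>
      ∀ b : Fin n, s'.arr 7 b = countBelow (fun a => a ∈ D ∧ Dominates G a b) n := by
  classical
  refine (Runs.forVertices hs (by omega) (by decide) (by decide) (fun k s' =>
      ∀ b : Fin n, s'.arr 7 b = countBelow (fun a => a ∈ D ∧ Dominates G a b) k)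
    (fun k s y h => h) (fun a => 6 * (adj a).length + 9) ?_ ?_).mono ?_ fun _ _ h => h
  · simp [countBelow_zero, h7]
  · intro a s₁ hsa hs₁ ha₁ hI
    have h3₁ : s₁.arr 3 = s.arr 3 := hsa.arr 3 (by decide)
    have h3a := h3 a
    have ha := a.2
    have hcount : ∀ b, countBelow (fun a => a ∈ D ∧ Dominates G a b) a ≤ n :=
      fun b => countBelow_le _ _
    refine .step (T := 6 * (adj a).length + 8) (by simp [ha₁, h3₁]; omega) ?_
    refine .branch (fun h => ?_) fun h => ?_
    · simp [ha₁, h3₁, hs₁.zero] at h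
      have haD : a ∈ D := h3a.2.1 (by omega)
      have hca := hcount a
      refine .step (T := 6 * (adj a).length + 6) (by simp [ha₁, hI]; omega) <|
        .step (T := 6 * (adj a).length + 5) (by simp [ha₁, hI, hs₁.one]; omega) <|
        .step (T := 6 * (adj a).length + 4) (by simp [ha₁, hI, hs₁.one]; omega) ?_
      set s₂ := (Instr.write 7 3 17).apply ((Instr.add 17 17 1).apply ((Instr.load 17 7 3).apply
        ((Instr.load 16 3 3).apply s₁))) with hs₂
      have hs₂' : Holds adj ω s₂ := hs₁.agree (P := .countDominators)
        ((((Agree.apply _ (by decide) (by decide)).trans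
          (Agree.apply _ (by decide) (by decide))).trans
          (Agree.apply _ (by decide) (by decide))).trans
          (Agree.apply _ (by decide) (by decide))) (by decide)
      refine (Runs.forNeighbors (j := 4) hs₂' (by omega) (a := a) (by simp [hs₂, ha₁])
        (by decide) (by decide) (by decide) (by decide) (by decide) (fun l s' => ∀ b : Fin n,
          s'.arr 7 b = countBelow (fun a => a ∈ D ∧ Dominates G a b) a +
            if a = b ∨ b ∈ l then 1 else 0) (fun _ _ _ h => h) (fun _ _ _ h => h)
          (fun _ _ _ h => h) 3 ?_ ?_).mono (by omega) ?_
      · intro b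
        by_cases hab : a = b
        · simp [hs₂, ha₁, hs₁.one, hI, hab]
        · have hba : b ≠ a := fun h => hab h.symm
          simp [hs₂, ha₁, hI, hab, hba, Fin.val_inj]
      · intro l b r hl s₃ _ hs₃ hb hJ
        -- Adjacency lists have no repetitions, so no counter is increased twice for the same
        -- dominator.
        have hbl : b ∉ l := by
          have := (hG a).1
          rw [hl, List.nodup_append] at this
          exact fun h => this.2.2 b h b (by simp) rfl
        have hab : a ≠ b := by
          have : b ∈ adj a := by simp [hl]
          exact (((hG a).2 b).1 this).ne
        have hcb := hcount b
        have hJb := hJ b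
        simp only [hab, hbl, or_self, if_false, add_zero] at hJb
        refine .step (T := 2) (by simp [hb, hJb]; omega) <|
          .step (T := 1) (by simp [hb, hJb, hs₃.one]; omega) <|
          .instr (by simp [hb, hJb, hs₃.one]; omega) fun c => ?_
        by_cases hcb : c = b
        · simp [hb, hcb, hJb, hs₃.one]
        · simpa [hb, hcb, Fin.val_inj] using hJ c
      · intro s' _ h b
        rw [h b, countBelow_succ]
        simp [haD, (hG a).2, Dominates]
    · simp [ha₁, h3₁, hs₁.zero] at h
      have haD : a ∉ D := fun h' => by have := h3a.2.2 h'; omega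
      refine (Runs.skip ?_).mono (by omega) fun _ _ h => h
      intro b
      rw [countBelow_succ]
      simpa [haD] using hI b
  · simp only [Finset.sum_add_distrib, ← Finset.mul_sum, ← offset_eq_sum]
    simp
    omega

theorem Runs.checkCounts (hs : Holds adj ω s) (hw : n + 1 ≤ w) {D : Set (Fin n)}
    {c : Fin n → ℕ} {p : Prop} (h3 : ∀ a : Fin n, s.arr 3 a ≤ 1 ∧ (s.arr 3 a = 1 ↔ a ∈ D))
    (h7 : ∀ a : Fin n, s.arr 7 a = c a) (hc : ∀ a, c a ≤ n) (hD : ∀ a ∈ D, c a ≠ 1 → p)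
    (h23 : 0 < s.reg 23 → p) (h24 : s.reg 24 = 0) :
    Runs w .checkCounts s (9 * n + 2) fun s' =>
      (0 < s'.reg 23 → p) ∧ (s'.reg 23 = 0 → s.reg 23 = 0 ∧ ∀ a ∈ D, c a = 1) ∧
        (0 < s'.reg 24 → ∃ a, c a ≠ 1) ∧ (s'.reg 24 = 0 → ∀ a, a ∉ D → c a = 1) := by
  refine (Runs.forVertices hs (by omega) (by decide) (by decide) (fun k s' =>
      (0 < s'.reg 23 → p) ∧ (s'.reg 23 = 0 → s.reg 23 = 0 ∧ ∀ a ∈ D, a.1 < k → c a = 1) ∧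
        (0 < s'.reg 24 → ∃ a, c a ≠ 1) ∧ (s'.reg 24 = 0 → ∀ a, a ∉ D → a.1 < k → c a = 1))
    (fun k s y h => h) (fun a => 7) ?_ ?_).mono (by simp; omega)
    fun _ _ h => ⟨h.1, fun h' => ⟨(h.2.1 h').1, fun a ha => (h.2.1 h').2 a ha a.2⟩, h.2.2.1,
      fun h' a ha => h.2.2.2 h' a ha a.2⟩
  · exact ⟨h23, fun h => ⟨h, by simp⟩, by simp [h24], by simp⟩
  · rintro a s₁ hsa hs₁ ha₁ ⟨hI₁, hI₂, hI₃, hI₄⟩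
    have h3₁ : s₁.arr 3 = s.arr 3 := hsa.arr 3 (by decide)
    have h7₁ : s₁.arr 7 = s.arr 7 := hsa.arr 7 (by decide)
    have h3a := h3 a
    have hca := hc a
    have hlt : ∀ b : Fin n, b ≠ a → b.1 < a + 1 → b.1 < a := fun b hb hb' => by omega
    refine .step (T := 6) (by simp [ha₁, h3₁]; omega) <|
      .step (T := 5) (by simp [ha₁, h7₁, h7]; omega) ?_
    have hbad : c a ≠ 1 → Runs w (.branch 2 17 (.instr (.const 23 1)) (.instr (.const 24 1)))
        ((Instr.load 16 7 3).apply ((Instr.load 17 3 3).apply s₁)) 2 fun s' =>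
        (0 < s'.reg 23 → p) ∧ (s'.reg 23 = 0 → s.reg 23 = 0 ∧ ∀ b ∈ D, b.1 < a + 1 → c b = 1) ∧
          (0 < s'.reg 24 → ∃ a, c a ≠ 1) ∧
            (s'.reg 24 = 0 → ∀ b, b ∉ D → b.1 < a + 1 → c b = 1) := by
      intro hca
      refine .branch (fun h => .instr (by simp; omega) ?_) fun h => .instr (by simp; omega) ?_
      · have h' : 0 < s.arr 3 a := by simpa [ha₁, h3₁, hs₁.zero] using h
        have haD : a ∈ D := h3a.2.1 (by omega)
        refine ⟨fun _ => hD a haD hca, by simp, by simpa using hI₃, ?_⟩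
        intro h24 b hb hba
        exact hI₄ (by simpa using h24) b hb (hlt b (fun h => hb (h ▸ haD)) hba)
      · have h' : ¬ 0 < s.arr 3 a := by simpa [ha₁, h3₁, hs₁.zero] using h
        have haD : a ∉ D := fun h'' => by have := h3a.2.2 h''; omega
        refine ⟨by simpa using hI₁, ?_, fun _ => ⟨a, hca⟩, by simp⟩
        intro h23
        have := hI₂ (by simpa using h23)
        exact ⟨this.1, fun b hb hba => this.2 b hb (hlt b (fun h => haD (h ▸ hb)) hba)⟩
    refine .branch (fun h => (hbad ?_).mono (show 2 ≤ 4 by omega) fun _ _ h => h) fun h =>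
      .branch (fun h' => (hbad ?_).mono (show 2 ≤ 3 by omega) fun _ _ h => h) fun h' => ?_
    · simp [ha₁, h7₁, h7, hs₁.one] at h
      omega
    · simp [ha₁, h7₁, h7, hs₁.one] at h'
      omega
    · simp [ha₁, h7₁, h7, hs₁.one] at h h'
      have hca : c a = 1 := by omega
      have hall : ∀ b : Fin n, b.1 < a + 1 → (b.1 < a → c b = 1) → c b = 1 := by
        intro b hb hb'
        by_cases hba : b = a
        · rw [hba, hca]
        · exact hb' (hlt b hba hb)
      refine (Runs.skip ?_).mono (show 1 ≤ 3 by omega) fun _ _ h => h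
      refine ⟨by simpa using hI₁, fun h => ?_, by simpa using hI₃, fun h b hb hba => ?_⟩
      · have := hI₂ (by simpa using h)
        exact ⟨this.1, fun b hb hba => hall b hba (this.2 b hb)⟩
      · exact hall b hba (hI₄ (by simpa using h) b hb)

theorem countBelow_eq_one_iff {p : Fin n → Prop} : countBelow p n = 1 ↔ ∃! a, p a := by
  classical
  rw [countBelow, Finset.card_eq_one]
  constructor
  · rintro ⟨a, ha⟩
    have : ∀ b, p b ↔ b = a := fun b => by
      simpa using Finset.ext_iff.1 ha b
    exact ⟨a, (this a).2 rfl, fun b hb => (this b).1 hb⟩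
  · rintro ⟨a, ha, hu⟩
    refine ⟨a, ?_⟩
    ext b
    simp only [Finset.mem_filter, Finset.mem_univ, true_and, b.2, Finset.mem_singleton]
    exact ⟨hu b, fun h => h ▸ ha⟩

/-- The answer in the memory is correct. -/
def Answers (G : SimpleGraph (Fin n)) (ω : Fin n → ℕ) (s : Store) : Prop :=
  (s.reg 0 = 1 ∧ IsMinWeightED G ω (outputSet n s)) ∨
    (s.reg 0 = 0 ∧ ¬ ∃ D : Set (Fin n), IsED G D) ∨ (s.reg 0 = 2 ∧ ¬ TwoPTwoFree G)

theorem coe_outputSet {D : Set (Fin n)} (h : ∀ a : Fin n, s.arr 3 a = 1 ↔ a ∈ D) :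
    (outputSet n s : Set (Fin n)) = D := by
  ext a
  simp [outputSet, h]

theorem isMinWeightED_of_unique {D : Finset (Fin n)} (hD : IsED G (D : Set (Fin n)))
    (hu : ∀ E : Set (Fin n), IsED G E → E = D) : IsMinWeightED G ω D := by
  refine ⟨hD, fun D' hD' => ?_⟩
  rw [Finset.coe_injective (hu D' hD')]

theorem Runs.solveHubless (hG : IsAdjLists G adj) (hs : Holds adj ω s)
    (hw : n + offset adj n + 2 ≤ w) (hscan : ScanDegrees G adj n s) (hcore : 0 < coreSize G)
    (hhub : ∀ a, ¬ IsHub G a) (h4 : ∀ i, s.arr 4 i = 0) (h6 : ∀ i, s.arr 6 i = 0)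
    (h7 : ∀ i, s.arr 7 i = 0) (h18 : s.reg 18 = 0) (h20 : s.reg 20 = 0) (h23 : s.reg 23 = 0)
    (h24 : s.reg 24 = 0) :
    Runs w .solveHubless s (53 * offset adj n + 37 * n + 27) (Answers G ω) := by
  classical
  obtain ⟨v, hv, hvdeg, hvi⟩ : ∃ v : Fin n, s.reg 12 = v ∧ s.reg 11 = (adj v).length ∧
      v ∉ isolated G := by
    -- The initial value n of register 11 exceeds every degree, so it cannot survive the scan of a
    -- non-isolated vertex.
    refine hscan.min_eq.resolve_left fun h => ?_
    rw [coreSize_eq_card, Finset.card_pos] at hcore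
    obtain ⟨a, ha⟩ := hcore
    have h1 := hscan.min_le a a.2 (by simpa using ha)
    have h2 := hG.length_lt a
    omega
  have hmin : ∀ a, a ∉ isolated G → (adj v).length ≤ (adj a).length := fun a ha =>
    hvdeg ▸ hscan.min_le a a.2 ha
  obtain ⟨x, r, hx⟩ : ∃ x r, adj v = x :: r := by
    rw [← List.ne_nil_iff_exists_cons, ← List.length_pos_iff]
    rw [hG.mem_isolated_iff] at hvi
    omega
  have hvx : G.Adj v x := by rw [← (hG v).2, hx]; simp
  have hvlen : (adj v).length ≤ offset adj n := by
    have h1 := offset_succ adj v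
    have h2 := offset_mono adj (show v.1 + 1 ≤ n from v.2)
    omega
  set S : Set (Fin n) := {a | a ∈ far G v ∧ ¬ G.Adj x a} with hS
  have hmemS : ∀ a, a ∈ S ↔ ¬ Dominates G v a ∧ ¬ G.Adj x a := fun _ => Iff.rfl
  set c : Fin n → ℕ := fun b => countBelow (fun a => a ∈ insert v S ∧ Dominates G a b) n with hc
  refine .step (T := 53 * offset adj n + 37 * n + 26) (by simp [hs.one]; omega) ?_
  set s₁ := (Instr.write 4 12 1).apply s with hs₁
  have hs₁' : Holds adj ω s₁ := hs.agree (P := .instr (.write 4 12 1))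
    (Agree.apply _ (by decide) (by decide)) (by decide)
  refine ((Runs.markNeighbors (a := v) hs₁' (by omega) (by simp [hs₁, hv])
    (by decide)).seq (T' := 49 * offset adj n + 37 * n + 22)
    fun s₂ hs₂ h4₂ => ?_).mono (by omega) fun _ _ h => h
  have hs₂' := hs₁'.agree hs₂ (by decide)
  have hfar : ∀ a : Fin n, s₂.arr 4 a ≤ 1 ∧ (s₂.arr 4 a < 1 ↔ a ∈ far G v) := by
    intro a
    have := h4₂ a
    rw [(hG v).2] at this
    by_cases hva : G.Adj v a
    · simp [this.1 hva, far, Dominates, hva]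
    · rw [this.2 hva]
      by_cases hav : a = v
      · simp [hs₁, hav, hv, hs.one, far, Dominates]
      · have : v ≠ a := fun h => hav h.symm
        simp [hs₁, hav, hv, h4, far, Dominates, hva, Fin.val_inj, this]
  refine ((Runs.findCore hG hs₂' (by omega) (fun a => (hfar a).2) (fun a => (hfar a).1) ?_).seq
    (T' := 43 * offset adj n + 25 * n + 20) fun s₃ hs₃ hcore₃ => ?_).mono (by omega)
    fun _ _ h => h
  · rw [hs₂.reg 18 (by decide)]; simp [hs₁, h18]
  have hs₃' := hs₂'.agree hs₃ (by decide)
  have hv₃ : s₃.reg 12 = v := by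
    rw [hs₃.reg 12 (by decide), hs₂.reg 12 (by decide)]; simp [hs₁, hv]
  have h4₃ : s₃.arr 4 = s₂.arr 4 := hs₃.arr 4 (by decide)
  refine ((Runs.excludeNeighbors hs₃' hG (by omega) hv₃ hmin
    (by simpa [h4₃] using fun a => (hfar a).2)
    (by simpa [h4₃] using fun a => (hfar a).1) ?_ ?_ ?_ hcore₃).seq
    (T' := 10 * offset adj n + 25 * n + 16) fun s₄ hs₄ hex => ?_).mono (by omega)
    fun _ _ h => h
  · intro a
    rw [hs₃.arr 6 (by decide), hs₂.arr 6 (by decide)]; simp [hs₁, h6]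
  · rw [hs₃.reg 20 (by decide), hs₂.reg 20 (by decide)]; simp [hs₁, h20]
  · rw [hs₃.reg 23 (by decide), hs₂.reg 23 (by decide)]; simp [hs₁, h23]
  have hs₄' := hs₃'.agree hs₄ (by decide)
  have hv₄ : s₄.reg 12 = v := by rw [hs₄.reg 12 (by decide), hv₃]
  have h4₄ : s₄.arr 4 = s₂.arr 4 := by rw [hs₄.arr 4 (by decide), h4₃]
  have h3₄ : s₄.arr 3 = s.arr 3 := by
    rw [hs₄.arr 3 (by decide), hs₃.arr 3 (by decide), hs₂.arr 3 (by decide)]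
    funext i
    simp [hs₁]
  refine ((Runs.buildCandidate hG hs₄' (by omega) hv₄ hx (by simpa [h4₄] using fun a => (hfar a).2)
    (fun a => ?_) (by simpa [h3₄] using hscan.mark_le)
    (by simpa [h4₄] using fun a => (hfar a).1)).seq
    (T' := 6 * offset adj n + 20 * n + 7) fun s₅ hs₅ hcand => ?_).mono (by omega)
    fun _ _ h => h
  · rw [h3₄, hscan.mark]; simp
  have hs₅' := hs₄'.agree hs₅ (by decide)
  replace hcand : ∀ a : Fin n, s₅.arr 3 a ≤ 1 ∧ (s₅.arr 3 a = 1 ↔ a ∈ insert v S) := hcand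
  refine ((Runs.countDominators hG hs₅' (by omega) hcand fun a => ?_).seq
    (T' := 9 * n + 5) fun s₆ hs₆ hcount => ?_).mono (by omega)
    fun _ _ h => h
  · rw [hs₅.arr 7 (by decide), hs₄.arr 7 (by decide), hs₃.arr 7 (by decide),
      hs₂.arr 7 (by decide)]
    simp [hs₁, h7]
  have hs₆' := hs₅'.agree hs₆ (by decide)
  have h3₆ : s₆.arr 3 = s₅.arr 3 := hs₆.arr 3 (by decide)
  have h23₆ : s₆.reg 23 = s₄.reg 23 := by rw [hs₆.reg 23 (by decide), hs₅.reg 23 (by decide)]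
  have hdom : ∀ a b, a ∈ insert v S → Dominates G a b → c b = 1 → ∀ d ∈ insert v S,
      Dominates G d b → d = a := by
    intro a b ha hab hcb d hd hdb
    rw [hc] at hcb
    exact (countBelow_eq_one_iff.1 hcb).unique ⟨hd, hdb⟩ ⟨ha, hab⟩
  -- In a `2P₂`-free graph `S` is independent and far from v, so each vertex of the candidate is
  -- dominated by itself only.
  have hbad : ∀ a ∈ insert v S, c a ≠ 1 → ¬ TwoPTwoFree G := by
    intro a ha hca hfree
    have hind := hfree.isIndepSet hvx fun a ha => (hmemS a).1 ha
    refine hca (countBelow_eq_one_iff.2 ⟨a, ⟨ha, Or.inl rfl⟩, ?_⟩)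
    rintro d ⟨hd, hda⟩
    rcases hda with hda | hda
    · exact hda
    · rcases hd with rfl | hd <;> rcases ha with rfl | ha
      · rfl
      · exact absurd (Or.inr hda) ((hmemS a).1 ha).1
      · exact absurd (Or.inr hda.symm) ((hmemS d).1 hd).1
      · exact absurd hda (hind hd ha hda.ne)
  refine ((Runs.checkCounts (p := ¬ TwoPTwoFree G) hs₆' (by omega) (by rwa [h3₆]) hcount
    (fun a => countBelow_le _ _) hbad ?_ ?_).seq (T' := 3) fun s₇ hs₇ ⟨hr1, hr2, hr3, hr4⟩ =>
    ?_).mono (by omega) fun _ _ h => h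
  · intro h
    rw [h23₆] at h
    rcases hex with hex | hex
    · omega
    · exact hex.2
  · rw [hs₆.reg 24 (by decide), hs₅.reg 24 (by decide), hs₄.reg 24 (by decide),
      hs₃.reg 24 (by decide), hs₂.reg 24 (by decide)]
    simp [hs₁, h24]
  have hs₇' := hs₆'.agree hs₇ (by decide)
  -- when no induced `2P₂` has been found, there is only one candidate
  have huniq : s₇.reg 23 = 0 → ∀ E : Set (Fin n), IsED G E → E = insert v S := by
    intro h0 E hE
    obtain ⟨h1, h2⟩ := hr2 h0
    rw [h23₆] at h1
    have hcov := (hex.resolve_right fun h => by omega).2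
    have hnot : ∀ u, G.Adj v u → u ∉ E := by
      intro u hu
      refine hE.notMem_of_farCore (hhub u) hu (fun d hd hsub => ?_) (hcov u hu)
      -- The degree of d would be smaller than that of v, against the choice of v.
      have h1 : (adj d).toFinset ⊆ (adj v).toFinset.erase u := by
        intro y hy
        rw [List.mem_toFinset, (hG d).2] at hy
        have := hsub hy
        rw [Finset.mem_erase, List.mem_toFinset, (hG v).2]
        exact ⟨this.2, this.1⟩
      have h2 := Finset.card_le_card h1
      have h3 : u ∈ (adj v).toFinset := by rw [List.mem_toFinset, (hG v).2]; exact hu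
      rw [Finset.card_erase_of_mem h3, List.toFinset_card_of_nodup (hG d).1,
        List.toFinset_card_of_nodup (hG v).1] at h2
      have h4 := hmin d hd
      have h5 : 0 < (adj v).length := by rw [hx]; simp
      omega
    have hvE : v ∈ E := by
      obtain ⟨d, hd, rfl | hdv⟩ := hE.exists_dominates v
      · exact hd
      · exact absurd hd (hnot d hdv.symm)
    -- Independence of `S` is read off from the counts, since `2P₂`-freeness is not available:
    -- adjacent a, b in `S` would both dominate b.
    refine hE.eq_insert hvE hvx hmemS fun a ha b hb hab h => hab ?_
    exact hdom b b (Or.inr hb) (Or.inl rfl) (h2 b (Or.inr hb)) a (Or.inr ha) (Or.inr h)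
  refine .branch (fun h => (Runs.instr (by simp; omega) ?_).mono (show 1 ≤ 2 by omega)
    fun _ _ h => h) fun h => .branch (fun h' => .instr (by simp) ?_) fun h' =>
    .instr (by simp; omega) ?_
  · rw [hs₇'.zero] at h
    exact Or.inr (Or.inr ⟨by simp, hr1 h⟩)
  · rw [hs₇'.zero] at h h'
    refine Or.inr (Or.inl ⟨by simp, ?_⟩)
    rintro ⟨E, hE⟩
    obtain ⟨a, ha⟩ := hr3 h'
    rw [huniq (by omega) E hE] at hE
    exact ha (countBelow_eq_one_iff.2 (hE a))
  · rw [hs₇'.zero] at h h'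
    have hout : (outputSet n ((Instr.const 0 1).apply s₇) : Set (Fin n)) = insert v S := by
      refine coe_outputSet fun a => ?_
      rw [arr_const, hs₇.arr 3 (by decide), h3₆]
      exact (hcand a).2
    refine Or.inl ⟨by simp, isMinWeightED_of_unique ?_ ?_⟩
    · rw [hout]
      intro a
      by_cases ha : a ∈ insert v S
      · exact countBelow_eq_one_iff.1 ((hr2 (by omega)).2 a ha)
      · exact countBelow_eq_one_iff.1 (hr4 (by omega) a ha)
    · rw [hout]
      exact huniq (by omega)

/-- All e.d.s contain the isolated vertices and differ only in the hub. -/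
theorem isMinWeightED_of_isHub {D : Finset (Fin n)} {z : Fin n} (hz : IsHub G z)
    (hmin : ∀ a, IsHub G a → ω z ≤ ω a) (hD : (D : Set (Fin n)) = insert z (isolated G)) :
    IsMinWeightED G ω D := by
  classical
  refine ⟨hD ▸ hz.isED, fun D' hD' => ?_⟩
  obtain ⟨d, hd, hD'⟩ := hz.eq_insert_of_isED hD'
  set I : Finset (Fin n) := Finset.univ.filter fun a => a ∈ isolated G with hI
  have h1 : D = insert z I := Finset.coe_injective (by rw [hD]; ext; simp [hI])
  have h2 : D' = insert d I := Finset.coe_injective (by rw [hD']; ext; simp [hI])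
  rw [h1, h2, Finset.sum_insert (by simpa [hI] using hz.1),
    Finset.sum_insert (by simpa [hI] using hd.1)]
  have := hmin d hd
  omega

theorem Runs.solve (hG : IsAdjLists G adj)
    (hw : n + offset adj n + Finset.univ.sup ω + 2 ≤ w) :
    Runs w .solve (initStore adj ω) (53 * offset adj n + 63 * n + 35) (Answers G ω) := by
  refine .step (T := 53 * offset adj n + 63 * n + 34) (by simp; omega) <|
    .step (T := 53 * offset adj n + 63 * n + 33) (by simp [initStore]; omega) ?_
  set s₁ := (Instr.move 11 0).apply ((Instr.const 1 1).apply (initStore adj ω)) with hs₁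
  have hreg : ∀ x, 11 < x → s₁.reg x = 0 := by
    intro x hx
    simp [hs₁, initStore, show x ≠ 11 by omega, show x ≠ 1 by omega, show x ≠ 0 by omega]
  have harr : ∀ a i, 2 < a → s₁.arr a i = 0 := by
    intro a i ha
    simp [hs₁, initStore, show a ≠ 0 by omega, show a ≠ 1 by omega, show a ≠ 2 by omega]
  have hs₁' : Holds adj ω s₁ :=
    ⟨by simp [hs₁, initStore], by simp [hs₁], by simp [hs₁, initStore], by simp [hs₁]⟩
  refine ((Runs.scanDegrees hG hs₁' (by omega) ?_ ?_ fun a => harr 3 a (by omega)).seq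
    (T' := 53 * offset adj n + 52 * n + 31) fun s₂ hs₂ hscan => ?_).mono (by omega) fun _ _ h => h
  · simp [hs₁, initStore]
  · simp [hs₁, initStore]
  have hs₂' := hs₁'.agree hs₂ (by decide)
  refine ((Runs.findHub hG hs₂' (by omega) hscan.size ?_).seq
    (T' := 53 * offset adj n + 37 * n + 29) fun s₃ hs₃ hhub => ?_).mono (by omega) fun _ _ h => h
  · rw [hs₂.reg 13 (by decide), hreg 13 (by omega)]
  have hs₃' := hs₂'.agree hs₃ (by decide)
  have h10 : s₃.reg 10 = coreSize G := by rw [hs₃.reg 10 (by decide)]; exact hscan.size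
  have h3 : s₃.arr 3 = s₂.arr 3 := hs₃.arr 3 (by decide)
  have hmark : ∀ a : Fin n, s₃.arr 3 a = 1 ↔ a ∈ isolated G := by
    intro a; rw [h3, hscan.mark]; simp
  refine .branch (fun h => (Runs.instr (by simp; omega) ?_).mono (by omega) fun _ _ h => h)
    fun h => .branch (fun h' => ?_) fun h' => ?_
  -- No vertex has a neighbour (this includes the empty graph), so the set of all vertices, already
  -- marked in array 3, is the only e.d.
  · rw [h10, hs₃'.one] at h
    have hiso : ∀ a, a ∈ isolated G := by
      intro a
      by_contra ha
      have := hG.length_lt_coreSize ha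
      omega
    have hout : (outputSet n ((Instr.const 0 1).apply s₃) : Set (Fin n)) = Set.univ := by
      refine coe_outputSet fun a => ?_
      rw [arr_const, hmark]
      simp [hiso]
    refine Or.inl ⟨by simp, isMinWeightED_of_unique ?_ ?_⟩
    · rw [hout]
      exact isED_univ hiso
    · rw [hout]
      exact fun E hE => Set.eq_univ_of_forall fun a => hE.isolated_subset (hiso a)
  · rw [hs₃'.zero] at h'
    obtain ⟨-, z, hz, hzhub, -, hzmin⟩ := hhub.resolve_left fun h => by omega
    refine (Runs.step (T := 1) (by simp [hs₃'.one]; omega) <|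
      .instr (by simp; omega) (Or.inl ⟨by simp, ?_⟩)).mono (by omega) fun _ _ h => h
    refine isMinWeightED_of_isHub hzhub (fun a ha => hzmin a a.2 ha) (coe_outputSet fun a => ?_)
    by_cases haz : a = z
    · simp [haz, hz, hs₃'.one]
    · simp [haz, hz, hmark, Fin.val_inj]
  · rw [hs₃'.zero] at h'
    rw [h10, hs₃'.one] at h
    have hno := (hhub.resolve_right fun h => by omega).2
    have hscan₃ : ScanDegrees G adj n s₃ := by
      refine ⟨h10, ?_, ?_, by rw [h3]; exact hscan.4, by rw [h3]; exact hscan.5⟩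
      · rw [hs₃.reg 11 (by decide)]; exact hscan.2
      · rw [hs₃.reg 11 (by decide), hs₃.reg 12 (by decide)]; exact hscan.3
    refine (Runs.solveHubless hG hs₃' (by omega) hscan₃ (by omega) (fun a => hno a a.2)
      ?_ ?_ ?_ ?_ ?_ ?_ ?_).mono (by omega) fun _ _ h => h
    · intro i; rw [hs₃.arr 4 (by decide), hs₂.arr 4 (by decide), harr 4 i (by omega)]
    · intro i; rw [hs₃.arr 6 (by decide), hs₂.arr 6 (by decide), harr 6 i (by omega)]
    · intro i; rw [hs₃.arr 7 (by decide), hs₂.arr 7 (by decide), harr 7 i (by omega)]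
    · rw [hs₃.reg 18 (by decide), hs₂.reg 18 (by decide), hreg 18 (by omega)]
    · rw [hs₃.reg 20 (by decide), hs₂.reg 20 (by decide), hreg 20 (by omega)]
    · rw [hs₃.reg 23 (by decide), hs₂.reg 23 (by decide), hreg 23 (by omega)]
    · rw [hs₃.reg 24 (by decide), hs₂.reg 24 (by decide), hreg 24 (by omega)]

end

/-! ### The linear time bounds -/

theorem wedRobustlyLinearTime_twoPTwoFree :
    WEDRobustlyLinearTime (fun _ G => TwoPTwoFree G) := by
  -- The program takes at most 53 steps per cell of the adjacency array, up to terms in n, and that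
  -- array has 2m cells.
  refine ⟨.solve, 106, fun n G ω adj hG => ?_⟩
  have hoff := hG.offset_eq
  obtain ⟨t, s, h1, h2, h3⟩ := Runs.solve (ω := ω) hG
    (w := 106 * (n + G.edgeSet.ncard + Finset.univ.sup ω + 1)) (by omega)
  exact ⟨t, s, h1, by omega, h3⟩

/-- With zero weights the input is the unweighted one and the largest weight disappears from the
bound on the word size. -/
theorem WEDRobustlyLinearTime.ed {𝒞 : ∀ n : ℕ, SimpleGraph (Fin n) → Prop}
    (h : WEDRobustlyLinearTime 𝒞) : EDRobustlyLinearTime 𝒞 := by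
  obtain ⟨P, c, h⟩ := h
  refine ⟨P, c, fun n G adj hG => ?_⟩
  obtain ⟨t, s, h1, h2, h3⟩ := h n G (fun _ => 0) adj hG
  have h0 : Finset.univ.sup (fun _ : Fin n => 0) = 0 := by simp
  rw [h0, Nat.add_zero] at h1
  exact ⟨t, s, h1, h2, h3.imp_left fun h => ⟨h.1, _, h.2.1⟩⟩

end EffDom

theorem mainTheorem7 :
    EffDom.WEDRobustlyLinearTime (fun _ G => EffDom.TwoPTwoFree G) ∧
    EffDom.EDRobustlyLinearTime (fun _ G => EffDom.TwoPTwoFree G) ∧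
    (∀ (V : Type*) [Finite V] [Nontrivial V] (G : SimpleGraph V),
      G.Connected → EffDom.IsPrimeGraph G → EffDom.TwoPTwoFree G →
        ((∃ D : Set V, EffDom.IsED G D) ↔ EffDom.IsThinSpider G)) ∧
    (∀ (V : Type*) [Finite V] [Nontrivial V] (G : SimpleGraph V) (R : Set V),
      G.Connected → Gᶜ.Connected → EffDom.IsCharacteristicSet G R →
        (∀ I : Set V, EffDom.IsCharacteristicSpider G R I →
          ∀ D : Set V, EffDom.IsED G D ↔ D = I) ∧
        (EffDom.TwoPTwoFree G → (∃ D : Set V, EffDom.IsED G D) →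
          ∃ I : Set V, EffDom.IsCharacteristicSpider G R I)) :=
  ⟨EffDom.wedRobustlyLinearTime_twoPTwoFree, EffDom.wedRobustlyLinearTime_twoPTwoFree.ed,
    fun _ _ _ _ hc hp hG => EffDom.isED_iff_isThinSpider hc hp hG,
    fun _ _ _ _ _ hc hcc hR =>
      ⟨fun _ hI D => EffDom.isED_iff_of_isCharacteristicSpider hc hcc hR hI D,
        fun hG ⟨D, hD⟩ => ⟨D, EffDom.exists_isCharacteristicSpider hc hcc hR hG hD⟩⟩⟩
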